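/- Let $D\in\mathbb N$, let $F:\mathbb R^D\to\mathbb R^D$ and $L:\mathbb R^D\to\mathbb R$ be $C^\infty$, let $t_S<t_E$, and let $y:[t_S,t_E]\to\mathbb R^D$ solve $y'=F(y)$. A comma in an index list denotes partial derivatives, and repeated indices are summed. For $t\in[t_S,t_E]$ let $\Phi_t$ map $x$ to the value at time $t_E$ of the solution of $z'=F(z)$ with $z(t)=x$, and let $\mathcal L_t=L\circ\Phi_t$. Consider on $[t_S,t_E]$ the equations $$\sigma_i'=-\sigma_kF_{k,i}(y),\qquad h_{ij}'=-h_{mj}F_{m,i}(y)-h_{im}F_{m,j}(y)-\sigma_mF_{m,ij}(y),$$ with terminal values $\sigma(t_E)=\nabla L(y(t_E))$ and $h(t_E)=\nabla^2L(y(t_E))$, and the truncated equation, without the last term (to which Eq. (9) of Liu et al. reduces for an end-state loss and no trainable parameters), $$k_{ij}'=-k_{mj}F_{m,i}(y)-k_{im}F_{m,j}(y),\qquad k(t_E)=\nabla^2L(y(t_E)).$$ 1. **Backward system.** A solution $(\sigma,h)$ exists on $[t_S,t_E]$. For every $t\in[t_S,t_E]$, $\Phi_t$ is well defined in a neighbourhood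 of $y(t)$, $\mathcal L_t$ is $C^2$ at $y(t)$, and every solution $(\sigma,h)$ satisfies $\nabla\mathcal L_t(y(t))=\sigma(t)$ and $\nabla^2\mathcal L_t(y(t))=h(t)$. In particular, $\sigma(t_S)$ and $h(t_S)$ are the gradient and the Hessian of $y_S\mapsto L(\Phi_{t_S}(y_S))$ at $y_S=y(t_S)$. 2. **The term is necessary.** A solution $k$ of the truncated equation exists, and $k(t)=\nabla^2\mathcal L_t(y(t))$ holds for all $t\in[t_S,t_E]$ if and only if $\sigma_m(t)F_{m,ij}(y(t))=0$ for all $t\in[t_S,t_E]$ and all $i,j$ ("the term vanishes along $y$"). 3. **Cases in which it vanishes.** If $F$ is linear up to a constant, $F(y)=Ay+c$, then the term vanishes along $y$. If $\nabla L(y(t_E))=0$, then $\sigma\equiv0$ on $[t_S,t_E]$ and the term vanishes along $y$. 4. **Only these cases ensure that it vanishes.** (a) For given $F$ and $y$ there is a linear subspace $W\subseteq\mathbb R^D$ such that, for every smooth $L$, the term vanishes along $y$ if and only if $\nabla L(y(t_E))\in W$. Moreover, $W=\mathbb R^D$ if and only if $F_{m,ij}(y(t))=0$ for all $t\in[t_S,t_E]$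 and all $m,i,j$. (b) If a smooth $F$ is not of the form $F(y)=Ay+c$, then there are $t_S<t_E$, a solution $y$ of $y'=F(y)$ on $[t_S,t_E]$ and a smooth $L$ such that the term does not vanish along $y$ and $k(t_S)\ne\nabla^2\mathcal L_{t_S}(y(t_S))$. (c) If $L$ is smooth and $\nabla L(y_E)\neq0$, then for all $t_S<t_E$ there are a smooth $F$ and a solution $y$ of $y'=F(y)$ on $[t_S,t_E]$ with $y(t_E)=y_E$ such that the term does not vanish along $y$ and $k(t_S)\ne\nabla^2\mathcal L_{t_S}(y(t_S))$. -/

import Mathlib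

open Set Filter Topology
open scoped ContDiff

/-- The state space `ℝ^D`. -/
abbrev State (D : ℕ) : Type := EuclideanSpace ℝ (Fin D)

/-- The partial derivative `∂f/∂y_i` at `x`. -/
noncomputable def partialDeriv {D : ℕ} (i : Fin D) (f : State D → ℝ) (x : State D) : ℝ :=
  fderiv ℝ f x (EuclideanSpace.single i 1)

/-- The vector of first partial derivatives, `f_{,i}`. -/
noncomputable def grad {D : ℕ} (f : State D → ℝ) (x : State D) : Fin D → ℝ :=
  fun i => partialDeriv i f x

/-- The matrix of second partial derivatives, `f_{,ij}`. -/
noncomputable def hess {D : ℕ} (f : State D → ℝ) (x : State D) : Matrix (Fin D) (Fin D) ℝ :=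
  Matrix.of fun i j => partialDeriv j (partialDeriv i f) x

/-- `F_{m,i}(x)`. -/
noncomputable def jac {D : ℕ} (F : State D → State D) (x : State D) (m i : Fin D) : ℝ :=
  grad (fun z => F z m) x i

/-- `F_{m,ij}(x)`. -/
noncomputable def jac2 {D : ℕ} (F : State D → State D) (x : State D) (m i j : Fin D) : ℝ :=
  hess (fun z => F z m) x i j

/-- `y` solves `y' = F(y)` on `[a, b]` (with one-sided derivatives at the end points). -/
def IsTrajectory {D : ℕ} (F : State D → State D) (a b : ℝ) (y : ℝ → State D) : Prop :=
  ∀ t ∈ Icc a b, HasDerivWithinAt y (F (y t)) (Icc a b) t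

open Classical in
/-- The flow of `y' = F(y)` from time `a` to time `b`: the value at `b` of the solution that
starts at `x` at time `a`, and `0` if there is no such solution on `[a, b]`. -/
noncomputable def flowMap {D : ℕ} (F : State D → State D) (a b : ℝ) (x : State D) : State D :=
  if hx : ∃ y : ℝ → State D, IsTrajectory F a b y ∧ y a = x then hx.choose b else 0

/-- The loss of the end state at time `b`, as a function of the state at time `t`. -/
noncomputable def lossFrom {D : ℕ} (F : State D → State D) (L : State D → ℝ) (t b : ℝ) :
    State D → ℝ :=
  fun x => L (flowMap F t b x)

/-- The term `σ_m(t) F_{m,ij}(y(t))`. -/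
noncomputable def curvatureTerm {D : ℕ} (F : State D → State D) (y : ℝ → State D)
    (σ : ℝ → Fin D → ℝ) (t : ℝ) (i j : Fin D) : ℝ :=
  ∑ m, σ t m * jac2 F (y t) m i j

/-- The term `σ_m F_{m,ij}` is zero at all times in `[a, b]`. -/
def CurvatureTermVanishes {D : ℕ} (F : State D → State D) (a b : ℝ) (y : ℝ → State D)
    (σ : ℝ → Fin D → ℝ) : Prop :=
  ∀ t ∈ Icc a b, ∀ i j, curvatureTerm F y σ t i j = 0

/-- `σ` solves `σ_i' = -σ_k F_{k,i}(y)` on `[a, b]` with terminal value `σ(b) = ∇L(y(b))`. -/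
def IsCostate {D : ℕ} (F : State D → State D) (L : State D → ℝ) (a b : ℝ) (y : ℝ → State D)
    (σ : ℝ → Fin D → ℝ) : Prop :=
  σ b = grad L (y b) ∧
  ∀ t ∈ Icc a b, ∀ i,
    HasDerivWithinAt (fun s => σ s i) (-∑ k, σ t k * jac F (y t) k i) (Icc a b) t

/-- `h` solves `h_ij' = -h_mj F_{m,i} - h_im F_{m,j} - σ_m F_{m,ij}` on `[a, b]` along `y`, with
terminal value `h(b) = ∇²L(y(b))`. -/
def IsBackwardHessian {D : ℕ} (F : State D → State D) (L : State D → ℝ) (a b : ℝ)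
    (y : ℝ → State D) (σ : ℝ → Fin D → ℝ) (h : ℝ → Matrix (Fin D) (Fin D) ℝ) : Prop :=
  h b = hess L (y b) ∧
  ∀ t ∈ Icc a b, ∀ i j,
    HasDerivWithinAt (fun s => h s i j)
      (-(∑ m, h t m j * jac F (y t) m i) - (∑ m, h t i m * jac F (y t) m j)
        - curvatureTerm F y σ t i j) (Icc a b) t

/-- `k` solves the equation without the curvature term,
`k_ij' = -k_mj F_{m,i} - k_im F_{m,j}` on `[a, b]` along `y`, with `k(b) = ∇²L(y(b))`. -/
def IsTruncatedHessian {D : ℕ} (F : State D → State D) (L : State D → ℝ) (a b : ℝ)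
    (y : ℝ → State D) (k : ℝ → Matrix (Fin D) (Fin D) ℝ) : Prop :=
  k b = hess L (y b) ∧
  ∀ t ∈ Icc a b, ∀ i j,
    HasDerivWithinAt (fun s => k s i j)
      (-(∑ m, k t m j * jac F (y t) m i) - (∑ m, k t i m * jac F (y t) m j)) (Icc a b) t

/-- `F` is linear in `y`, up to a constant: `F(y) = A y + c`. -/
def IsAffineField {D : ℕ} (F : State D → State D) : Prop :=
  ∃ (A : State D →ₗ[ℝ] State D) (c : State D), ∀ x, F x = A x + c

/-! The backward equations are dual to the first and second variational equations. If `w` and `ζ`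
solve `w' = DF(y) w` and `η` solves the same equation with source `D²F(y)(ζ, w)`, then both `σ · w`
and `h(w, ζ) + σ · η` are constant in time (the two `pairing_eq` lemmas). At the end time they are
the first and second derivatives of the end-state loss; at the start, with `w`, `ζ` basis vectors
and `η = 0`, they are the entries of `σ` and `h`. The curvature term in the equation for `h` is what
balances the source of `η`.

This needs differentiability of the flow (`exists_endMap`). The inverse function theorem is applied
on `C([a, b], X)` to `z ↦ z - ∫ F(z)`, whose derivative is the identity minus a Volterra operator.
That is invertible on an interval of any length, because high powers of a Volterra operator are
small; the same fact solves all linear equations here. Second derivatives of the flow come from the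
first-order result for the doubled field `(x, v) ↦ (F x, DF(x) v)`.

If `k` is the Hessian at all times, it equals `h`, and comparing the two equations forces the term
to vanish; otherwise `h - k` is driven by the term alone. The remaining claims use that the costate
can be prescribed at any one time. A nonzero second derivative is detected on a short trajectory by
a coordinate function as loss, and a nonzero gradient by a quadratic field at rest at the end point.
-/

/-! ### Smoothness of superposition operators on `C(K, X)` -/

section Superposition

universe u

variable {K : Type*} [TopologicalSpace K] [CompactSpace K]

/-- Pointwise application of a continuous family of operators to a continuous function. -/
noncomputable def pointwiseApply (K : Type*) [TopologicalSpace K] [CompactSpace K]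
    (X Y : Type*) [NormedAddCommGroup X] [NormedSpace ℝ X]
    [NormedAddCommGroup Y] [NormedSpace ℝ Y] :
    C(K, X →L[ℝ] Y) →L[ℝ] C(K, X) →L[ℝ] C(K, Y) :=
  LinearMap.mkContinuous₂
    (LinearMap.mk₂ ℝ (fun (A : C(K, X →L[ℝ] Y)) (v : C(K, X)) =>
        (⟨fun s => A s (v s), A.continuous.clm_apply v.continuous⟩ : C(K, Y)))
      (fun _ _ _ => by ext; simp) (fun _ _ _ => by ext; simp)
      (fun _ _ _ => by ext; simp) (fun _ _ _ => by ext; simp)) 1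
    (fun A v => by
      rw [ContinuousMap.norm_le _ (by positivity), one_mul]
      intro s
      exact ((A s).le_opNorm (v s)).trans
        (mul_le_mul (A.norm_coe_le_norm s) (v.norm_coe_le_norm s) (norm_nonneg _) (norm_nonneg A)))

/-- The mean value inequality at each `s` bounds the remainder by the oscillation of `F'` near `z
s`. Compactness of `K` makes this uniform in `s`: postcomposition with `F'` is continuous in the sup
norm. -/
theorem hasFDerivAt_superposition {X Y : Type*} [NormedAddCommGroup X] [NormedSpace ℝ X]
    [NormedAddCommGroup Y] [NormedSpace ℝ Y] (F : C(X, Y)) (F' : C(X, X →L[ℝ] Y))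
    (hF : ∀ x, HasFDerivAt F (F' x) x) (z : C(K, X)) :
    HasFDerivAt (fun z : C(K, X) => F.comp z) (pointwiseApply K X Y (F'.comp z)) z := by
  rw [hasFDerivAt_iff_isLittleO_nhds_zero, Asymptotics.isLittleO_iff]
  intro c hc
  have hcont : Continuous fun w : C(K, X) => F'.comp w := ContinuousMap.continuous_postcomp F'
  obtain ⟨δ, hδ, H⟩ := (Metric.continuous_iff (f := fun w : C(K, X) => F'.comp w)).1 hcont z c hc
  filter_upwards [Metric.ball_mem_nhds (0 : C(K, X)) hδ] with v hv
  rw [mem_ball_zero_iff] at hv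
  rw [ContinuousMap.norm_le _ (by positivity)]
  intro s
  have key := (convex_ball (z s) δ).norm_image_sub_le_of_norm_hasFDerivWithin_le' (𝕜 := ℝ)
    (f := F) (f' := F') (φ := F' (z s)) (C := c)
    (fun x _ => (hF x).hasFDerivWithinAt) (fun x hx => ?_)
    (Metric.mem_ball_self hδ) (y := z s + v s) ?_
  · simp only [add_sub_cancel_left] at key
    refine key.trans ?_
    gcongr
    exact v.norm_coe_le_norm s
  -- Translating `z` by a constant turns a point `x` near `z s` into a function near `z`, so the
  -- sup-norm continuity of `F'.comp` applies at `s`.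
  · have h1 := H (z + ContinuousMap.const K (x - z s)) (by
      rw [dist_eq_norm, add_sub_cancel_left]
      refine lt_of_le_of_lt ((ContinuousMap.norm_le _ (norm_nonneg _)).2 fun _ => le_rfl) ?_
      exact mem_ball_iff_norm.1 hx)
    have h2 := (ContinuousMap.dist_apply_le_dist s).trans h1.le
    simpa [dist_eq_norm] using h2
  · rw [mem_ball_iff_norm, add_sub_cancel_left]
    exact (v.norm_coe_le_norm s).trans_lt hv

/-- The derivative is a bounded linear map applied to the superposition operator of `fderiv ℝ F`,
one order less smooth. Its target is `X →L[ℝ] Y`, so `Y` is quantified inside the induction and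
shares the universe of `X`. -/
theorem contDiff_superposition_nat {X : Type u} [NormedAddCommGroup X] [NormedSpace ℝ X] (n : ℕ) :
    ∀ (Y : Type u) [NormedAddCommGroup Y] [NormedSpace ℝ Y] (F : C(X, Y)), ContDiff ℝ n F →
      ContDiff ℝ n (fun z : C(K, X) => F.comp z) := by
  induction n with
  | zero =>
    intro Y _ _ F _
    exact contDiff_zero.2 (ContinuousMap.continuous_postcomp F)
  | succ n ih =>
    intro Y _ _ F hF
    have hF' : ContDiff ℝ n (fderiv ℝ F) := hF.fderiv_right (by norm_cast)
    rw [Nat.cast_succ, contDiff_succ_iff_hasFDerivAt]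
    exact ⟨_, (pointwiseApply K X Y).contDiff.comp (ih (X →L[ℝ] Y) ⟨fderiv ℝ F, hF'.continuous⟩ hF'),
      hasFDerivAt_superposition F _
        fun x => (hF.differentiable (by simp) x).hasFDerivAt⟩

theorem contDiff_superposition {X Y : Type u} [NormedAddCommGroup X] [NormedSpace ℝ X]
    [NormedAddCommGroup Y] [NormedSpace ℝ Y] (F : C(X, Y)) (hF : ContDiff ℝ ∞ F) :
    ContDiff ℝ ∞ (fun z : C(K, X) => F.comp z) :=
  contDiff_infty.2 fun n => contDiff_superposition_nat n Y F (contDiff_infty.1 hF n)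

end Superposition

/-! ### Volterra operators and linear differential equations -/

section Volterra

theorem intervalIntegrable_projIcc {X : Type*} [NormedAddCommGroup X] {a b : ℝ} (hab : a ≤ b) (v : C(Icc a b, X)) (s t : ℝ) :
    IntervalIntegrable (fun u => v (projIcc a b hab u)) MeasureTheory.volume s t :=
  (v.continuous.comp continuous_projIcc).intervalIntegrable s t

variable {X : Type*} [NormedAddCommGroup X] [NormedSpace ℝ X] {a b : ℝ}

theorem hasDerivAt_integral_projIcc [CompleteSpace X] (hab : a ≤ b) (t₀ : ℝ) (v : C(Icc a b, X))
    (t : ℝ) :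
    HasDerivAt (fun u => ∫ s in t₀..u, v (projIcc a b hab s)) (v (projIcc a b hab t)) t :=
  ((v.continuous.comp continuous_projIcc).integral_hasStrictDerivAt t₀ t).hasDerivAt

theorem norm_integral_projIcc_le (hab : a ≤ b) {s t : ℝ} (v : C(Icc a b, X))
    (hs : s ∈ Icc a b) (ht : t ∈ Icc a b) :
    ‖∫ u in s..t, v (projIcc a b hab u)‖ ≤ (b - a) * ‖v‖ := by
  refine (intervalIntegral.norm_integral_le_of_norm_le_const
    fun u _ => v.norm_coe_le_norm _).trans ?_
  rw [mul_comm]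
  gcongr
  rw [abs_le]
  constructor <;> linarith [hs.1, hs.2, ht.1, ht.2]

/-- The primitive of a continuous function on `[a, b]` that vanishes at `t₀`. -/
noncomputable def primitive [CompleteSpace X] (hab : a ≤ b) (t₀ : Icc a b) :
    C(Icc a b, X) →L[ℝ] C(Icc a b, X) :=
  LinearMap.mkContinuous
    { toFun := fun v => ⟨fun t => ∫ s in (t₀ : ℝ)..t, v (projIcc a b hab s),
        (continuous_iff_continuousAt.2 fun t =>
          (hasDerivAt_integral_projIcc hab t₀ v t).continuousAt).comp continuous_subtype_val⟩
      map_add' := fun v w => by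
        ext t
        exact intervalIntegral.integral_add (intervalIntegrable_projIcc hab v _ _)
          (intervalIntegrable_projIcc hab w _ _)
      map_smul' := fun c v => by
        ext t
        exact intervalIntegral.integral_smul c _ } (b - a)
    (fun v => (ContinuousMap.norm_le _ (mul_nonneg (sub_nonneg.2 hab) (norm_nonneg _))).2
      fun t => norm_integral_projIcc_le hab v t₀.2 t.2)

/-- The Volterra operator `v ↦ (t ↦ ∫_{t₀}^t A(s) v(s) ds)`. -/
noncomputable def volterra [CompleteSpace X] (hab : a ≤ b) (t₀ : Icc a b)
    (A : C(Icc a b, X →L[ℝ] X)) : C(Icc a b, X) →L[ℝ] C(Icc a b, X) :=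
  (primitive hab t₀).comp (pointwiseApply _ X X A)

/-- Each application integrates the bound on the previous power once more from `t₀`, which produces
the factorial. The absolute value covers times on both sides of `t₀`, so terminal value problems are
included. -/
theorem norm_volterra_pow_apply_le [CompleteSpace X] (hab : a ≤ b) (t₀ : Icc a b)
    (A : C(Icc a b, X →L[ℝ] X)) (v : C(Icc a b, X)) (n : ℕ) (t : Icc a b) :
    ‖(volterra hab t₀ A ^ n) v t‖ ≤ (‖A‖ ^ n * ‖v‖ / n.factorial) * |(t : ℝ) - t₀| ^ n := by
  induction n generalizing t with
  | zero => simpa using v.norm_coe_le_norm t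
  | succ n ih =>
    rw [pow_succ', mul_apply_eq_comp]
    change ‖∫ s in (t₀ : ℝ)..t, A (projIcc a b hab s)
      ((volterra hab t₀ A ^ n) v (projIcc a b hab s))‖ ≤ _
    rw [intervalIntegral.norm_intervalIntegral_eq]
    calc
      _ ≤ ∫ s in uIoc (t₀ : ℝ) t, (‖A‖ * (‖A‖ ^ n * ‖v‖ / n.factorial)) * |s - t₀| ^ n := by
        apply MeasureTheory.norm_integral_le_of_norm_le (Continuous.integrableOn_uIoc (by fun_prop))
        refine (MeasureTheory.ae_restrict_mem measurableSet_uIoc).mono fun s hs => ?_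
        have hs' : s ∈ Icc a b := (uIoc_subset_uIcc.trans (uIcc_subset_Icc t₀.2 t.2)) hs
        rw [mul_assoc]
        refine ((A _).le_opNorm _).trans (mul_le_mul (A.norm_coe_le_norm _) ?_ (norm_nonneg _)
          (norm_nonneg A))
        have := ih ⟨s, hs'⟩
        rwa [projIcc_of_mem hab hs']
      _ = _ := by
        rw [MeasureTheory.integral_const_mul, integral_pow_abs_sub_uIoc, Nat.factorial_succ]
        push_cast
        field_simp
        ring

/-- Some power has norm below one, so `1 - V ^ n` is invertible; it is the product of `1 - V` with a
geometric sum, and the factors commute. -/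
theorem isUnit_one_sub_volterra [CompleteSpace X] (hab : a ≤ b) (t₀ : Icc a b)
    (A : C(Icc a b, X →L[ℝ] X)) : IsUnit (1 - volterra hab t₀ A) := by
  have hlim := FloorSemiring.tendsto_pow_div_factorial_atTop (‖A‖ * (b - a))
  obtain ⟨n, hn⟩ := (hlim.eventually (gt_mem_nhds one_pos)).exists
  have hba := sub_nonneg.2 hab
  have hnorm : ‖volterra hab t₀ A ^ n‖ < 1 := by
    refine lt_of_le_of_lt (ContinuousLinearMap.opNorm_le_bound _ (by positivity) fun v => ?_) hn
    rw [ContinuousMap.norm_le _ (by positivity)]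
    intro t
    refine (norm_volterra_pow_apply_le hab t₀ A v n t).trans ?_
    have : |(t : ℝ) - t₀| ≤ b - a := by
      rw [abs_le]; constructor <;> linarith [t.2.1, t.2.2, t₀.2.1, t₀.2.2]
    calc _ ≤ (‖A‖ ^ n * ‖v‖ / n.factorial) * (b - a) ^ n := by gcongr
      _ = _ := by rw [mul_pow]; ring
  have hu := isUnit_one_sub_of_norm_lt_one (R := C(Icc a b, X) →L[ℝ] C(Icc a b, X)) hnorm
  rw [← mul_neg_geom_sum] at hu
  refine ((Commute.isUnit_mul_iff ?_).1 hu).1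
  exact (Commute.sum_right _ _ _ fun i _ =>
    ((Commute.one_left _).sub_left (Commute.refl _)).pow_right i)

theorem hasDerivWithinAt_Icc_unique {z w g : ℝ → X} {t₀ : ℝ} (ht₀ : t₀ ∈ Icc a b)
    (hz : ∀ t ∈ Icc a b, HasDerivWithinAt z (g t) (Icc a b) t)
    (hw : ∀ t ∈ Icc a b, HasDerivWithinAt w (g t) (Icc a b) t) (h : z t₀ = w t₀) :
    ∀ t ∈ Icc a b, z t = w t := by
  intro t ht
  have := (convex_Icc a b).norm_image_sub_le_of_norm_hasDerivWithin_le (C := 0)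
    (f := fun s => z s - w s) (f' := fun s => g s - g s)
    (fun s hs => (hz s hs).sub (hw s hs)) (fun s _ => by simp) ht₀ ht
  simpa [h, sub_eq_zero] using this

/-- A solution of the integral equation is a solution of the differential equation. -/
theorem hasDerivWithinAt_of_eq_add_primitive [CompleteSpace X] (hab : a ≤ b) (t₀ : Icc a b) (x : X)
    (z v : C(Icc a b, X)) (h : z = ContinuousMap.const _ x + primitive hab t₀ v) :
    z t₀ = x ∧ ∀ t (ht : t ∈ Icc a b),
      HasDerivWithinAt (fun s => z (projIcc a b hab s)) (v ⟨t, ht⟩) (Icc a b) t := by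
  have hz : ∀ t, z t = x + ∫ s in (t₀ : ℝ)..t, v (projIcc a b hab s) := fun t => by
    conv_lhs => rw [h]
    rfl
  refine ⟨by simp [hz], fun t ht => ?_⟩
  have h1 := ((hasDerivAt_integral_projIcc hab t₀ v t).const_add x).hasDerivWithinAt (s := Icc a b)
  rw [projIcc_of_mem hab ht] at h1
  refine h1.congr (fun s hs => ?_) ?_
  · rw [hz, projIcc_of_mem hab hs]
  · rw [hz, projIcc_of_mem hab ht]

/-- A solution of the differential equation is a solution of the integral equation. -/
theorem eq_add_primitive_of_hasDerivWithinAt [CompleteSpace X] (hab : a ≤ b) (t₀ : Icc a b)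
    (z v : C(Icc a b, X)) (y : ℝ → X) (hy : ∀ t (ht : t ∈ Icc a b), y t = z ⟨t, ht⟩)
    (h : ∀ t (ht : t ∈ Icc a b), HasDerivWithinAt y (v ⟨t, ht⟩) (Icc a b) t) :
    z = ContinuousMap.const _ (z t₀) + primitive hab t₀ v := by
  obtain ⟨h1, h2⟩ := hasDerivWithinAt_of_eq_add_primitive hab t₀ (z t₀) _ v rfl
  ext t
  have := hasDerivWithinAt_Icc_unique (g := fun t => v (projIcc a b hab t)) t₀.2
    (fun t ht => by simpa only [projIcc_of_mem hab ht] using h t ht)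
    (fun t ht => by simpa only [projIcc_of_mem hab ht] using h2 t ht)
    (by rw [projIcc_of_mem hab t₀.2, h1, hy _ t₀.2]) t t.2
  rwa [hy _ t.2, projIcc_of_mem hab t.2] at this

/-- Linear initial value problems are solvable on the whole interval, from any initial time. -/
theorem exists_linear_solution [CompleteSpace X] {A : ℝ → X →L[ℝ] X} {B : ℝ → X}
    (hA : ContinuousOn A (Icc a b)) (hB : ContinuousOn B (Icc a b)) {t₀ : ℝ} (ht₀ : t₀ ∈ Icc a b)
    (x : X) :
    ∃ z : ℝ → X, z t₀ = x ∧
      ∀ t ∈ Icc a b, HasDerivWithinAt z (A t (z t) + B t) (Icc a b) t := by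
  have hab : a ≤ b := ht₀.1.trans ht₀.2
  let A' : C(Icc a b, X →L[ℝ] X) := ⟨_, hA.domRestrict⟩
  let B' : C(Icc a b, X) := ⟨_, hB.domRestrict⟩
  -- The integrated equation reads `(1 - V) z = x + ∫ B`.
  obtain ⟨z, hz⟩ := (ContinuousLinearMap.isUnit_iff_bijective.1
    (isUnit_one_sub_volterra hab ⟨t₀, ht₀⟩ A')).2
      (ContinuousMap.const _ x + primitive hab ⟨t₀, ht₀⟩ B')
  obtain ⟨h1, h2⟩ := hasDerivWithinAt_of_eq_add_primitive hab ⟨t₀, ht₀⟩ x z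
    (pointwiseApply _ X X A' z + B') (by
      rw [map_add, ← add_assoc, add_right_comm, ← hz]
      simp [volterra])
  refine ⟨fun s => z (projIcc a b hab s), ?_, fun t ht => ?_⟩
  · simpa only [projIcc_of_mem hab ht₀] using h1
  · simp only [projIcc_of_mem hab ht]
    exact h2 t ht

end Volterra

/-! ### Differentiability of the flow to second order -/

section EndMap

variable {X : Type*} [NormedAddCommGroup X] [NormedSpace ℝ X] {a b : ℝ}

/-- `y` solves the autonomous equation `y' = F(y)` on `[a, b]`. -/
def SolvesOn (F : X → X) (a b : ℝ) (y : ℝ → X) : Prop :=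
  ∀ t ∈ Icc a b, HasDerivWithinAt y (F (y t)) (Icc a b) t

/-- `w` solves the variational equation `w' = DF(y) w` on `[a, b]`. -/
def SolvesVariationOn (F : X → X) (a b : ℝ) (y w : ℝ → X) : Prop :=
  ∀ t ∈ Icc a b, HasDerivWithinAt w (fderiv ℝ F (y t) (w t)) (Icc a b) t

theorem SolvesOn.continuousOn {F : X → X} {y : ℝ → X} (hy : SolvesOn F a b y) :
    ContinuousOn y (Icc a b) := fun t ht => (hy t ht).continuousWithinAt

theorem SolvesVariationOn.continuousOn {F : X → X} {y w : ℝ → X}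
    (hw : SolvesVariationOn F a b y w) : ContinuousOn w (Icc a b) :=
  fun t ht => (hw t ht).continuousWithinAt

/-- Smooth dependence of the solutions of `y' = F(y)` on the initial value, near a solution on
`[a, b]`; the derivative is given by the variational equation. -/
theorem exists_endMap [CompleteSpace X] {F : X → X} (hF : ContDiff ℝ ∞ F) (hab : a ≤ b)
    {y : ℝ → X} (hy : SolvesOn F a b y) :
    ∃ Φ : X → X, ContDiffAt ℝ ∞ Φ (y a) ∧
      (∀ᶠ x in 𝓝 (y a), ∃ z, SolvesOn F a b z ∧ z a = x ∧ z b = Φ x) ∧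
      ∀ w, SolvesVariationOn F a b y w → fderiv ℝ Φ (y a) (w a) = w b := by
  have haI : a ∈ Icc a b := left_mem_Icc.2 hab
  have hbI : b ∈ Icc a b := right_mem_Icc.2 hab
  let F₀ : C(X, X) := ⟨F, hF.continuous⟩
  let F₁ : C(X, X →L[ℝ] X) := ⟨fderiv ℝ F, hF.continuous_fderiv (by simp)⟩
  let y₀ : C(Icc a b, X) := ⟨_, hy.continuousOn.domRestrict⟩
  let J := primitive (X := X) hab ⟨a, haI⟩
  -- The solutions with initial value `x` are the preimages under `Ψ` of the constant function `x`.
  let Ψ : C(Icc a b, X) → C(Icc a b, X) := fun z => z - J (F₀.comp z)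
  have hΨ : ContDiff ℝ ∞ Ψ := contDiff_id.sub (J.contDiff.comp (contDiff_superposition F₀ hF))
  obtain ⟨u, hu⟩ := isUnit_one_sub_volterra hab ⟨a, haI⟩ (F₁.comp y₀)
  let e := ContinuousLinearEquiv.unitsEquiv ℝ C(Icc a b, X) u
  have hΨ' : HasFDerivAt Ψ (e : C(Icc a b, X) →L[ℝ] C(Icc a b, X)) y₀ := by
    have h1 := (hasFDerivAt_id y₀).sub (J.hasFDerivAt.comp y₀ (hasFDerivAt_superposition F₀ F₁
      (fun x => (hF.differentiable (by simp) x).hasFDerivAt) y₀))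
    have h2 : (e : C(Icc a b, X) →L[ℝ] C(Icc a b, X)) = 1 - volterra hab ⟨a, haI⟩ (F₁.comp y₀) := by
      rw [← hu]; rfl
    rw [h2]
    exact h1
  have hn : (∞ : WithTop ℕ∞) ≠ 0 := by simp
  let G := hΨ.contDiffAt.localInverse hΨ' hn
  have hy₀ : Ψ y₀ = ContinuousMap.const _ (y a) := by
    have := eq_add_primitive_of_hasDerivWithinAt hab ⟨a, haI⟩ y₀ (F₀.comp y₀) y
      (fun t ht => rfl) hy
    rw [sub_eq_iff_eq_add]
    exact this
  have hG : ContDiffAt ℝ ∞ G (ContinuousMap.const _ (y a)) := by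
    rw [← hy₀]
    exact hΨ.contDiffAt.to_localInverse hΨ' hn
  let c : X →L[ℝ] C(Icc a b, X) := ContinuousLinearMap.const ℝ (Icc a b)
  let ev : C(Icc a b, X) →L[ℝ] X := ContinuousMap.evalCLM ℝ ⟨b, hbI⟩
  have hc : ContDiff ℝ ∞ c := ContinuousLinearMap.contDiff c
  have hc' : HasFDerivAt c c (y a) := ContinuousLinearMap.hasFDerivAt c
  have hev : ContDiff ℝ ∞ ev := ContinuousLinearMap.contDiff ev
  have hev' : ∀ g, HasFDerivAt ev ev g := fun g => ContinuousLinearMap.hasFDerivAt ev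
  have hG' : HasFDerivAt G (e.symm : C(Icc a b, X) →L[ℝ] C(Icc a b, X))
      (ContinuousMap.const _ (y a)) := by
    rw [← hy₀]
    exact (hΨ.contDiffAt.hasStrictFDerivAt' hΨ' hn).to_localInverse.hasFDerivAt
  have hGr : ∀ᶠ g in 𝓝 (ContinuousMap.const (Icc a b) (y a)), Ψ (G g) = g := by
    rw [← hy₀]
    exact (hΨ.contDiffAt.hasStrictFDerivAt' hΨ' hn).eventually_right_inverse
  -- The end map: constant function, local inverse of `Ψ`, evaluation at `b`.
  refine ⟨fun x => ev (G (c x)), ?_, ?_, ?_⟩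
  · exact hev.contDiffAt.comp (y a) (ContDiffAt.comp (y a) (g := G) (f := c) hG hc.contDiffAt)
  · filter_upwards [hc'.continuousAt.eventually hGr] with x hx
    obtain ⟨h1, h2⟩ := hasDerivWithinAt_of_eq_add_primitive hab ⟨a, haI⟩ x
      (G (c x)) _ (sub_eq_iff_eq_add.1 hx)
    refine ⟨fun s => G (c x) (projIcc a b hab s), fun t ht => ?_, ?_, ?_⟩
    · simp only [projIcc_of_mem hab ht]
      exact h2 t ht
    · simpa only [projIcc_of_mem hab haI] using h1
    · simp only [projIcc_of_mem hab hbI]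
      rfl
  · intro w hw
    have h1 : HasFDerivAt (fun x => ev (G (c x)))
        (ev.comp ((e.symm : C(Icc a b, X) →L[ℝ] C(Icc a b, X)).comp c)) (y a) :=
      (hev' _).comp (y a) (HasFDerivAt.comp (y a) (g := G) (f := c) hG' hc')
    let w₀ : C(Icc a b, X) := ⟨_, hw.continuousOn.domRestrict⟩
    have h2 := eq_add_primitive_of_hasDerivWithinAt hab ⟨a, haI⟩ w₀
      (pointwiseApply _ X X (F₁.comp y₀) w₀) w (fun t ht => rfl) hw
    -- The linearised operator sends a variation to its constant initial value, so the inverse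
    -- recovers the whole variation.
    have h3 : e w₀ = ContinuousMap.const _ (w a) := by
      have : e w₀ = w₀ - volterra hab ⟨a, haI⟩ (F₁.comp y₀) w₀ :=
        congrArg (fun f : C(Icc a b, X) →L[ℝ] C(Icc a b, X) => f w₀) hu
      rw [this, sub_eq_iff_eq_add]
      exact h2
    rw [h1.fderiv]
    change e.symm (ContinuousMap.const _ (w a)) ⟨b, hbI⟩ = w b
    rw [← h3, e.symm_apply_apply]
    rfl

/-- `F` need not be globally Lipschitz: both trajectories stay in one closed ball, where the
derivative is bounded. -/
theorem SolvesOn.eq_of_left_eq [FiniteDimensional ℝ X] {F : X → X} (hF : ContDiff ℝ 1 F)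
    {y z : ℝ → X} (hy : SolvesOn F a b y) (hz : SolvesOn F a b z) (h : y a = z a) :
    ∀ t ∈ Icc a b, y t = z t := by
  have hcomp : IsCompact (y '' Icc a b ∪ z '' Icc a b) :=
    (isCompact_Icc.image_of_continuousOn hy.continuousOn).union
      (isCompact_Icc.image_of_continuousOn hz.continuousOn)
  obtain ⟨R, hR⟩ := hcomp.isBounded.subset_closedBall (0 : X)
  have : ProperSpace X := FiniteDimensional.proper ℝ X
  obtain ⟨C, hC⟩ := (isCompact_closedBall (0 : X) R).exists_bound_of_continuousOn
    (hF.continuous_fderiv (by simp)).continuousOn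
  have hlip : LipschitzOnWith C.toNNReal F (Metric.closedBall (0 : X) R) :=
    (convex_closedBall _ _).lipschitzOnWith_of_nnnorm_hasFDerivWithin_le
      (fun x _ => (hF.differentiable (by simp) x).hasFDerivAt.hasFDerivWithinAt)
      fun x hx => by
        rw [← NNReal.coe_le_coe, coe_nnnorm]
        exact (hC x hx).trans (Real.le_coe_toNNReal C)
  have hder : ∀ {u : ℝ → X}, SolvesOn F a b u →
      ∀ t ∈ Ico a b, HasDerivWithinAt u (F (u t)) (Ici t) t := fun hu t ht =>
    (hu t (Ico_subset_Icc_self ht)).mono_of_mem_nhdsWithin (Icc_mem_nhdsGE_of_mem ht)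
  exact ODE_solution_unique_of_mem_Icc_right (v := fun _ => F)
    (s := fun _ => Metric.closedBall (0 : X) R) (fun _ _ => hlip)
    hy.continuousOn (hder hy)
    (fun t ht => hR (Or.inl (mem_image_of_mem y (Ico_subset_Icc_self ht))))
    hz.continuousOn (hder hz)
    (fun t ht => hR (Or.inr (mem_image_of_mem z (Ico_subset_Icc_self ht)))) h

/-- `Φ` maps initial values at time `a` to end values at time `b`. -/
def IsEndMap (F : X → X) (a b : ℝ) (Φ : X → X) : Prop :=
  ∀ z, SolvesOn F a b z → Φ (z a) = z b

theorem SolvesOn.eventually_exists [CompleteSpace X] {F : X → X} (hF : ContDiff ℝ ∞ F)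
    (hab : a ≤ b) {y : ℝ → X} (hy : SolvesOn F a b y) :
    ∀ᶠ x in 𝓝 (y a), ∃ z, SolvesOn F a b z ∧ z a = x := by
  obtain ⟨_, -, h, -⟩ := exists_endMap hF hab hy
  filter_upwards [h] with x ⟨z, hz, hza, _⟩ using ⟨z, hz, hza⟩

/-- Solutions exist from all nearby initial values, so every end map agrees near `y a` with the
smooth one from `exists_endMap`; its values elsewhere do not matter. -/
theorem IsEndMap.smooth [CompleteSpace X] {F Φ : X → X} (hΦ : IsEndMap F a b Φ)
    (hF : ContDiff ℝ ∞ F) (hab : a ≤ b) {y : ℝ → X} (hy : SolvesOn F a b y) :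
    ContDiffAt ℝ ∞ Φ (y a) ∧
      ∀ w, SolvesVariationOn F a b y w → fderiv ℝ Φ (y a) (w a) = w b := by
  obtain ⟨Φ', h1, h2, h3⟩ := exists_endMap hF hab hy
  have heq : Φ =ᶠ[𝓝 (y a)] Φ' := by
    filter_upwards [h2] with x ⟨z, hz, hza, hzb⟩
    rw [← hza, hΦ z hz, hza, hzb]
  exact ⟨h1.congr_of_eventuallyEq heq, fun w hw => by rw [heq.fderiv_eq, h3 w hw]⟩

theorem exists_variation [CompleteSpace X] {F : X → X} (hF : ContDiff ℝ ∞ F)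
    {y : ℝ → X} (hy : ContinuousOn y (Icc a b)) {t₀ : ℝ} (ht₀ : t₀ ∈ Icc a b) (x : X) :
    ∃ w : ℝ → X, w t₀ = x ∧ SolvesVariationOn F a b y w := by
  obtain ⟨w, hw0, hw⟩ := exists_linear_solution (B := fun _ => (0 : X))
    ((hF.continuous_fderiv (by simp)).comp_continuousOn hy) continuousOn_const ht₀ x
  exact ⟨w, hw0, fun t ht => by simpa using hw t ht⟩

/-- First derivative of an end-state function with respect to the initial value. -/
theorem IsEndMap.fderiv_comp [CompleteSpace X] {F Φ : X → X} (hΦ : IsEndMap F a b Φ)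
    (hF : ContDiff ℝ ∞ F) (hab : a ≤ b) {L : X → ℝ} (hL : ContDiff ℝ ∞ L) {y w : ℝ → X}
    (hy : SolvesOn F a b y) (hw : SolvesVariationOn F a b y w) :
    fderiv ℝ (fun x => L (Φ x)) (y a) (w a) = fderiv ℝ L (y b) (w b) := by
  obtain ⟨h1, h2⟩ := hΦ.smooth hF hab hy
  have := _root_.fderiv_comp (y a) (g := L) (f := Φ) (hL.differentiable (by simp) _)
    (h1.differentiableAt (by simp))
  rw [show (fun x => L (Φ x)) = L ∘ Φ from rfl, this, ContinuousLinearMap.comp_apply, h2 w hw,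
    hΦ y hy]

/-- Second derivative of an end-state function with respect to the initial value. -/
theorem IsEndMap.fderiv_fderiv_comp [CompleteSpace X] {F Φ : X → X} (hΦ : IsEndMap F a b Φ)
    (hF : ContDiff ℝ ∞ F) (hab : a ≤ b) {L : X → ℝ} (hL : ContDiff ℝ ∞ L) {y w ζ η : ℝ → X}
    (hy : SolvesOn F a b y) (hw : SolvesVariationOn F a b y w) (hζ : SolvesVariationOn F a b y ζ)
    (hη : ∀ t ∈ Icc a b, HasDerivWithinAt η
      (fderiv ℝ (fderiv ℝ F) (y t) (ζ t) (w t) + fderiv ℝ F (y t) (η t)) (Icc a b) t)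
    (hη0 : η a = 0) :
    fderiv ℝ (fderiv ℝ fun x => L (Φ x)) (y a) (ζ a) (w a) =
      fderiv ℝ (fderiv ℝ L) (y b) (ζ b) (w b) + fderiv ℝ L (y b) (η b) := by
  have hF' : ContDiff ℝ ∞ (fderiv ℝ F) := hF.fderiv_right (by simp)
  have hL' : ContDiff ℝ ∞ (fderiv ℝ L) := hL.fderiv_right (by simp)
  have hdF := hF'.differentiable (by simp)
  have hdL := hL'.differentiable (by simp)
  -- The end map of this doubled field is `(x, v) ↦ (Φ x, DΦ(x) v)` near the base point, and its
  -- variational equation along `(y, w)` is the system for `(ζ, η)`.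
  let F₂ : X × X → X × X := fun p => (F p.1, fderiv ℝ F p.1 p.2)
  have hF₂ : ContDiff ℝ ∞ F₂ :=
    (hF.comp contDiff_fst).prodMk ((hF'.comp contDiff_fst).clm_apply contDiff_snd)
  have hdF₂ : ∀ p q : X × X, fderiv ℝ F₂ p q =
      (fderiv ℝ F p.1 q.1, fderiv ℝ (fderiv ℝ F) p.1 q.1 p.2 + fderiv ℝ F p.1 q.2) := by
    intro p q
    have h := ((hF.differentiable (by simp) p.1).hasFDerivAt.comp p
      (hasFDerivAt_fst (𝕜 := ℝ))).prodMk
      (((hdF p.1).hasFDerivAt.comp p (hasFDerivAt_fst (𝕜 := ℝ))).clm_apply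
        (hasFDerivAt_snd (𝕜 := ℝ) (p := p)))
    have h' : HasFDerivAt F₂ _ p := h
    rw [h'.fderiv]
    simp [add_comm]
  have hy₂ : SolvesOn F₂ a b fun t => (y t, w t) := fun t ht => (hy t ht).prodMk (hw t ht)
  obtain ⟨Φ₂, h1, h2, h3⟩ := exists_endMap hF₂ hab hy₂
  have hv : SolvesVariationOn F₂ a b (fun t => (y t, w t)) fun t => (ζ t, η t) := fun t ht => by
    rw [hdF₂]
    exact (hζ t ht).prodMk (hη t ht)
  have h4 := h3 _ hv
  simp only [hη0] at h4
  have h5 : Φ₂ (y a, w a) = (y b, w b) := by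
    obtain ⟨z, hz, hza, hzb⟩ := h2.self_of_nhds
    have hz1 : SolvesOn F a b fun t => (z t).1 := fun t ht => (hz t ht).fst
    have hz2 : SolvesVariationOn F a b (fun t => (z t).1) fun t => (z t).2 :=
      fun t ht => (hz t ht).snd
    have e1 : (z a).1 = y a := by rw [hza]
    have e2 : (z a).2 = w a := by rw [hza]
    have e3 := hΦ _ hz1
    have e4 := (hΦ.smooth hF hab hz1).2 _ hz2
    rw [e1, hΦ y hy] at e3
    rw [e1, e2, (hΦ.smooth hF hab hy).2 w hw] at e4
    rw [← hzb, e3, e4]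
  let i : X → X × X := fun x => (x, w a)
  have hi : HasFDerivAt i ((ContinuousLinearMap.id ℝ X).prod 0) (y a) :=
    (hasFDerivAt_id _).prodMk (hasFDerivAt_const _ _)
  -- With the direction `w a` frozen, the first derivative at every nearby `x` is read off the
  -- doubled end map, so it can be differentiated again at `y a`.
  have heq : (fun x => fderiv ℝ (fun x => L (Φ x)) x (w a)) =ᶠ[𝓝 (y a)]
      fun x => fderiv ℝ L (Φ₂ (i x)).1 (Φ₂ (i x)).2 := by
    filter_upwards [hi.continuousAt.eventually h2] with x ⟨z, hz, hza, hzb⟩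
    have hz1 : SolvesOn F a b fun t => (z t).1 := fun t ht => (hz t ht).fst
    have hz2 : SolvesVariationOn F a b (fun t => (z t).1) fun t => (z t).2 :=
      fun t ht => (hz t ht).snd
    have e := hΦ.fderiv_comp hF hab hL hz1 hz2
    rw [← hzb, ← e, hza]
  have hΦ₂ : HasFDerivAt (fun x => Φ₂ (i x)) ((fderiv ℝ Φ₂ (y a, w a)).comp
      ((ContinuousLinearMap.id ℝ X).prod 0)) (y a) :=
    HasFDerivAt.comp (y a) (g := Φ₂) (f := i) (h1.differentiableAt (by simp)).hasFDerivAt hi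
  have hR := ((hdL (Φ₂ (i (y a))).1).hasFDerivAt.comp (y a) hΦ₂.fst).clm_apply hΦ₂.snd
  have hℓ : ContDiffAt ℝ ∞ (fun x => L (Φ x)) (y a) :=
    hL.contDiffAt.comp (y a) (hΦ.smooth hF hab hy).1
  have hℓ' : DifferentiableAt ℝ (fderiv ℝ fun x => L (Φ x)) (y a) :=
    (hℓ.fderiv_right (m := ∞) (by simp)).differentiableAt (by simp)
  have hLHS := hℓ'.hasFDerivAt.clm_apply (hasFDerivAt_const (w a) (y a))
  have key := congrArg (fun f : X →L[ℝ] ℝ => f (ζ a))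
    ((hLHS.congr_of_eventuallyEq heq.symm).unique hR)
  simpa [i, h5, h4, add_comm] using key

end EndMap

/-! ### Partial derivatives versus Fréchet derivatives -/

section Coordinates

variable {D : ℕ}

theorem map_eq_sum_coord {V : Type*} [NormedAddCommGroup V] [NormedSpace ℝ V]
    (f : State D →L[ℝ] V) (v : State D) :
    f v = ∑ i, v i • f (EuclideanSpace.single i 1) := by
  conv_lhs => rw [← (EuclideanSpace.basisFun (Fin D) ℝ).sum_repr v]
  simp [map_sum]

theorem hasFDerivAt_coord {F : State D → State D} {x : State D} {F' : State D →L[ℝ] State D}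
    (h : HasFDerivAt F F' x) (m : Fin D) :
    HasFDerivAt (fun z => F z m) ((EuclideanSpace.proj m).comp F') x :=
  (EuclideanSpace.proj (𝕜 := ℝ) m).hasFDerivAt.comp x h

/-- The index differentiated last fills the first slot. This order is kept throughout, so symmetry
of second derivatives is never used. -/
theorem hess_eq_fderiv {f : State D → ℝ} {x : State D} (hf : ContDiffAt ℝ 2 f x) (i j : Fin D) :
    hess f x i j = fderiv ℝ (fderiv ℝ f) x (EuclideanSpace.single j 1)
      (EuclideanSpace.single i 1) := by
  have h : DifferentiableAt ℝ (fderiv ℝ f) x :=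
    (hf.fderiv_right (m := 1) (by norm_num)).differentiableAt (by simp)
  have h1 := h.hasFDerivAt.clm_apply (hasFDerivAt_const (EuclideanSpace.single i (1 : ℝ)) x)
  change fderiv ℝ (fun z => fderiv ℝ f z (EuclideanSpace.single i 1)) x _ = _
  rw [h1.fderiv]
  simp

theorem fderiv_eq_sum_grad (f : State D → ℝ) (x v : State D) :
    fderiv ℝ f x v = ∑ i, grad f x i * v i := by
  rw [map_eq_sum_coord]
  exact Finset.sum_congr rfl fun i _ => mul_comm _ _

theorem fderiv_fderiv_eq_sum_hess {f : State D → ℝ} {x : State D} (hf : ContDiffAt ℝ 2 f x)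
    (ζ w : State D) :
    fderiv ℝ (fderiv ℝ f) x ζ w = ∑ i, ∑ j, hess f x i j * w i * ζ j := by
  rw [map_eq_sum_coord _ w]
  refine Finset.sum_congr rfl fun i _ => ?_
  rw [map_eq_sum_coord (fderiv ℝ (fderiv ℝ f) x) ζ]
  simp only [sum_apply, smul_apply, smul_eq_mul,
    Finset.mul_sum, hess_eq_fderiv hf]
  exact Finset.sum_congr rfl fun j _ => by ring

theorem fderiv_coord {F : State D → State D} (hF : ContDiff ℝ ∞ F) (m : Fin D) (x v : State D) :
    fderiv ℝ (fun z => F z m) x v = fderiv ℝ F x v m := by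
  rw [(hasFDerivAt_coord (hF.differentiable (by simp) x).hasFDerivAt m).fderiv]
  rfl

theorem contDiff_coord {F : State D → State D} (hF : ContDiff ℝ ∞ F) (m : Fin D) :
    ContDiff ℝ ∞ (fun z => F z m) :=
  (EuclideanSpace.proj (𝕜 := ℝ) m).contDiff.comp hF

theorem jac_eq_fderiv {F : State D → State D} (hF : ContDiff ℝ ∞ F) (x : State D) (m i : Fin D) :
    jac F x m i = fderiv ℝ F x (EuclideanSpace.single i 1) m :=
  fderiv_coord hF m x _

theorem fderiv_apply_eq_sum_jac {F : State D → State D} (hF : ContDiff ℝ ∞ F) (x v : State D)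
    (m : Fin D) : fderiv ℝ F x v m = ∑ i, jac F x m i * v i := by
  rw [← fderiv_coord hF, fderiv_eq_sum_grad]
  rfl

theorem fderiv_fderiv_coord {F : State D → State D} (hF : ContDiff ℝ ∞ F) (m : Fin D)
    (x ζ w : State D) :
    fderiv ℝ (fderiv ℝ fun z => F z m) x ζ w = fderiv ℝ (fderiv ℝ F) x ζ w m := by
  have h : (fderiv ℝ fun z => F z m) =
      fun z => (EuclideanSpace.proj (𝕜 := ℝ) m).comp (fderiv ℝ F z) :=
    funext fun z => (hasFDerivAt_coord (hF.differentiable (by simp) z).hasFDerivAt m).fderiv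
  have h2 : DifferentiableAt ℝ (fderiv ℝ F) x :=
    (hF.fderiv_right (m := ∞) (by simp)).differentiable (by simp) x
  rw [h, ((hasFDerivAt_const _ x).clm_comp h2.hasFDerivAt).fderiv]
  simp

theorem fderiv_fderiv_apply_eq_sum_jac2 {F : State D → State D} (hF : ContDiff ℝ ∞ F)
    (x ζ w : State D) (m : Fin D) :
    fderiv ℝ (fderiv ℝ F) x ζ w m = ∑ i, ∑ j, jac2 F x m i j * w i * ζ j := by
  rw [← fderiv_fderiv_coord hF, fderiv_fderiv_eq_sum_hess
    ((contDiff_coord hF m).of_le (by norm_cast)).contDiffAt]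
  rfl

theorem continuous_jac {F : State D → State D} (hF : ContDiff ℝ ∞ F) (m i : Fin D) :
    Continuous fun x => jac F x m i := by
  simp only [jac_eq_fderiv hF]
  have h := hF.continuous_fderiv (by simp)
  fun_prop

theorem jac2_eq_fderiv {F : State D → State D} (hF : ContDiff ℝ ∞ F) (x : State D)
    (m i j : Fin D) :
    jac2 F x m i j = fderiv ℝ (fderiv ℝ F) x (EuclideanSpace.single j 1)
      (EuclideanSpace.single i 1) m := by
  rw [fderiv_fderiv_apply_eq_sum_jac2 hF]
  simp [Finset.sum_ite_eq']

theorem continuous_jac2 {F : State D → State D} (hF : ContDiff ℝ ∞ F) (m i j : Fin D) :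
    Continuous fun x => jac2 F x m i j := by
  simp only [jac2_eq_fderiv hF]
  have h : Continuous (fderiv ℝ (fderiv ℝ F)) :=
    (hF.fderiv_right (m := ∞) (by simp)).continuous_fderiv (by simp)
  fun_prop

theorem hasDerivWithinAt_coord {w : ℝ → State D} {w' : State D} {s : Set ℝ} {t : ℝ}
    (h : HasDerivWithinAt w w' s t) (i : Fin D) :
    HasDerivWithinAt (fun u => w u i) (w' i) s t :=
  (EuclideanSpace.proj (𝕜 := ℝ) i).hasFDerivAt.comp_hasDerivWithinAt t h

end Coordinates

/-! ### The backward equations and their conserved pairings -/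

section Adjoint

variable {D : ℕ} {F : State D → State D} {L : State D → ℝ} {a b : ℝ} {y : ℝ → State D}

/-- `σ` solves the adjoint equation `σ_i' = -σ_k F_{k,i}(y)` on `[a, b]`. -/
def SolvesAdjointOn (F : State D → State D) (a b : ℝ) (y : ℝ → State D)
    (σ : ℝ → Fin D → ℝ) : Prop :=
  ∀ t ∈ Icc a b, ∀ i,
    HasDerivWithinAt (fun s => σ s i) (-∑ k, σ t k * jac F (y t) k i) (Icc a b) t

theorem SolvesOn.mono {X : Type*} [NormedAddCommGroup X] [NormedSpace ℝ X] {F : X → X}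
    {y : ℝ → X} (hy : SolvesOn F a b y) {t : ℝ} (ht : t ∈ Icc a b) : SolvesOn F t b y :=
  fun s hs => (hy s (Icc_subset_Icc_left ht.1 hs)).mono (Icc_subset_Icc_left ht.1)

theorem SolvesAdjointOn.mono {σ : ℝ → Fin D → ℝ} (hσ : SolvesAdjointOn F a b y σ) {t : ℝ}
    (ht : t ∈ Icc a b) : SolvesAdjointOn F t b y σ :=
  fun s hs i => (hσ s (Icc_subset_Icc_left ht.1 hs) i).mono (Icc_subset_Icc_left ht.1)

theorem SolvesAdjointOn.sub {σ τ : ℝ → Fin D → ℝ} (hσ : SolvesAdjointOn F a b y σ)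
    (hτ : SolvesAdjointOn F a b y τ) : SolvesAdjointOn F a b y (fun t i => σ t i - τ t i) :=
  fun t ht i => ((hσ t ht i).sub (hτ t ht i)).congr_deriv (by
    simp only [sub_mul, Finset.sum_sub_distrib]; ring)

theorem SolvesAdjointOn.const_mul {σ : ℝ → Fin D → ℝ} (hσ : SolvesAdjointOn F a b y σ) (c : ℝ) :
    SolvesAdjointOn F a b y (fun t i => c * σ t i) :=
  fun t ht i => ((hσ t ht i).const_mul c).congr_deriv (by
    simp only [mul_neg, Finset.mul_sum, mul_assoc])

/-- Solutions of the adjoint and of the variational equation have a constant pairing. -/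
theorem SolvesAdjointOn.pairing_eq (hF : ContDiff ℝ ∞ F) {σ : ℝ → Fin D → ℝ}
    (hσ : SolvesAdjointOn F a b y σ) {w : ℝ → State D} (hw : SolvesVariationOn F a b y w)
    (hab : a ≤ b) : ∑ i, σ a i * w a i = ∑ i, σ b i * w b i := by
  refine hasDerivWithinAt_Icc_unique (z := fun t => ∑ i, σ t i * w t i)
    (w := fun _ => ∑ i, σ b i * w b i) (g := fun _ => 0) (right_mem_Icc.2 hab) (fun t ht => ?_)
    (fun t _ => hasDerivWithinAt_const _ _ _) rfl a (left_mem_Icc.2 hab)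
  refine (HasDerivWithinAt.fun_sum fun i _ =>
    (hσ t ht i).mul (hasDerivWithinAt_coord (hw t ht) i)).congr_deriv ?_
  simp only [fderiv_apply_eq_sum_jac hF, Finset.sum_add_distrib, neg_mul, Finset.sum_mul,
    Finset.mul_sum, Finset.sum_neg_distrib]
  rw [Finset.sum_comm, neg_add_eq_zero]
  exact Finset.sum_congr rfl fun i _ => Finset.sum_congr rfl fun j _ => by ring

/-- Pairing with the variation that is a basis vector at time `t` isolates one component of `σ t`,
and the pairing is zero at `b`. -/
theorem SolvesAdjointOn.eq_zero (hF : ContDiff ℝ ∞ F) (hy : ContinuousOn y (Icc a b))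
    {σ : ℝ → Fin D → ℝ} (hσ : SolvesAdjointOn F a b y σ) (h : σ b = 0) :
    ∀ t ∈ Icc a b, σ t = 0 := by
  intro t ht
  ext i
  obtain ⟨w, hw0, hw⟩ := exists_variation (a := t) hF (hy.mono (Icc_subset_Icc_left ht.1))
    (left_mem_Icc.2 ht.2) (EuclideanSpace.single i 1)
  have := (hσ.mono ht).pairing_eq hF hw ht.2
  simpa [hw0, h, Pi.single_apply] using this

theorem SolvesAdjointOn.eq_of_right_eq (hF : ContDiff ℝ ∞ F) (hy : ContinuousOn y (Icc a b))
    {σ τ : ℝ → Fin D → ℝ} (hσ : SolvesAdjointOn F a b y σ) (hτ : SolvesAdjointOn F a b y τ)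
    (h : σ b = τ b) : ∀ t ∈ Icc a b, σ t = τ t := by
  intro t ht
  ext i
  have := congrFun ((hσ.sub hτ).eq_zero hF hy (by ext i; simp [h]) t ht) i
  simpa [sub_eq_zero] using this

/-- Linear initial value problems for a family of linear maps on a finite-dimensional space. -/
theorem exists_linear_solution_of_pointwise {X : Type*} [NormedAddCommGroup X] [NormedSpace ℝ X]
    [FiniteDimensional ℝ X] (A : ℝ → X →ₗ[ℝ] X) (B : ℝ → X)
    (hA : ∀ x, ContinuousOn (fun t => A t x) (Icc a b)) (hB : ContinuousOn B (Icc a b)) {t₀ : ℝ}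
    (ht₀ : t₀ ∈ Icc a b) (x : X) :
    ∃ z : ℝ → X, z t₀ = x ∧
      ∀ t ∈ Icc a b, HasDerivWithinAt z (A t (z t) + B t) (Icc a b) t := by
  have : CompleteSpace X := FiniteDimensional.complete ℝ X
  exact exists_linear_solution (A := fun t => LinearMap.toContinuousLinearMap (A t))
    (continuousOn_clm_apply.2 hA) hB ht₀ x

theorem exists_solvesAdjointOn (hF : ContDiff ℝ ∞ F) (hy : ContinuousOn y (Icc a b)) {t₀ : ℝ}
    (ht₀ : t₀ ∈ Icc a b) (g : Fin D → ℝ) :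
    ∃ σ : ℝ → Fin D → ℝ, σ t₀ = g ∧ SolvesAdjointOn F a b y σ := by
  obtain ⟨σ, h0, h⟩ := exists_linear_solution_of_pointwise
    (fun t => ({ toFun := fun σ i => -∑ k, σ k * jac F (y t) k i
                 map_add' := fun σ τ => by
                  ext i; simp only [Pi.add_apply, add_mul, Finset.sum_add_distrib, neg_add]
                 map_smul' := fun c σ => by
                  ext i
                  simp only [Pi.smul_apply, smul_eq_mul, Finset.mul_sum, mul_neg, mul_assoc,
                    RingHom.id_apply] } : (Fin D → ℝ) →ₗ[ℝ] Fin D → ℝ))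
    (fun _ => 0) (fun σ => continuousOn_pi.2 fun i => (continuousOn_finsetSum _ fun k _ =>
      continuousOn_const.mul ((continuous_jac hF k i).comp_continuousOn hy)).neg)
    continuousOn_const ht₀ g
  refine ⟨σ, h0, fun t ht i => ?_⟩
  simpa using hasDerivWithinAt_pi.1 (h t ht) i

/-- The operator of the truncated Hessian equation. -/
noncomputable def lyapunovMap (J : Fin D → Fin D → ℝ) :
    (Fin D → Fin D → ℝ) →ₗ[ℝ] Fin D → Fin D → ℝ where
  toFun h i j := -(∑ m, h m j * J m i) - ∑ m, h i m * J m j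
  map_add' h k := by
    ext i j
    simp only [Pi.add_apply, add_mul, Finset.sum_add_distrib]
    ring
  map_smul' c h := by
    ext i j
    simp only [Pi.smul_apply, smul_eq_mul, RingHom.id_apply, mul_assoc, ← Finset.mul_sum]
    ring

theorem exists_lyapunov_solution (hF : ContDiff ℝ ∞ F) (hy : ContinuousOn y (Icc a b))
    (B : ℝ → Fin D → Fin D → ℝ) (hB : ∀ i j, ContinuousOn (fun t => B t i j) (Icc a b)) {t₀ : ℝ}
    (ht₀ : t₀ ∈ Icc a b) (H : Fin D → Fin D → ℝ) :
    ∃ h : ℝ → Fin D → Fin D → ℝ, h t₀ = H ∧ ∀ t ∈ Icc a b, ∀ i j,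
      HasDerivWithinAt (fun s => h s i j)
        (-(∑ m, h t m j * jac F (y t) m i) - (∑ m, h t i m * jac F (y t) m j) + B t i j)
        (Icc a b) t := by
  obtain ⟨h, h0, hh⟩ := exists_linear_solution_of_pointwise
    (fun t => lyapunovMap (jac F (y t))) B
    (fun H => continuousOn_pi.2 fun i => continuousOn_pi.2 fun j =>
      (continuousOn_finsetSum _ fun m _ =>
        continuousOn_const.mul ((continuous_jac hF m i).comp_continuousOn hy)).neg.sub
      (continuousOn_finsetSum _ fun m _ =>
        continuousOn_const.mul ((continuous_jac hF m j).comp_continuousOn hy)))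
    (continuousOn_pi.2 fun i => continuousOn_pi.2 fun j => hB i j) ht₀ H
  exact ⟨h, h0, fun t ht i j => hasDerivWithinAt_pi.1 (hasDerivWithinAt_pi.1 (hh t ht) i) j⟩

theorem SolvesAdjointOn.continuousOn_curvatureTerm (hF : ContDiff ℝ ∞ F)
    (hy : ContinuousOn y (Icc a b)) {σ : ℝ → Fin D → ℝ} (hσ : SolvesAdjointOn F a b y σ)
    (i j : Fin D) : ContinuousOn (fun t => curvatureTerm F y σ t i j) (Icc a b) :=
  continuousOn_finsetSum _ fun m _ =>
    (show ContinuousOn (fun t => σ t m) (Icc a b) from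
      fun t ht => (hσ t ht m).continuousWithinAt).mul
      ((continuous_jac2 hF m i j).comp_continuousOn hy)

theorem exists_isCostate (hF : ContDiff ℝ ∞ F) (hy : ContinuousOn y (Icc a b)) (hab : a ≤ b)
    (L : State D → ℝ) : ∃ σ, IsCostate F L a b y σ :=
  exists_solvesAdjointOn hF hy (right_mem_Icc.2 hab) _

theorem exists_isTruncatedHessian (hF : ContDiff ℝ ∞ F) (hy : ContinuousOn y (Icc a b))
    (hab : a ≤ b) (L : State D → ℝ) : ∃ k, IsTruncatedHessian F L a b y k := by
  obtain ⟨k, h0, hk⟩ := exists_lyapunov_solution hF hy (fun _ _ _ => 0)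
    (fun _ _ => continuousOn_const) (right_mem_Icc.2 hab) (hess L (y b))
  exact ⟨k, h0, fun t ht i j => by simpa using hk t ht i j⟩

/-- With `σ` already known, the curvature term is a continuous source and the equation for `h` is
linear. -/
theorem exists_isBackwardHessian (hF : ContDiff ℝ ∞ F) (hy : ContinuousOn y (Icc a b))
    (hab : a ≤ b) (L : State D → ℝ) {σ : ℝ → Fin D → ℝ} (hσ : SolvesAdjointOn F a b y σ) :
    ∃ h, IsBackwardHessian F L a b y σ h := by
  obtain ⟨k, h0, hk⟩ := exists_lyapunov_solution hF hy (fun t i j => -curvatureTerm F y σ t i j)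
    (fun i j => (hσ.continuousOn_curvatureTerm hF hy i j).neg) (right_mem_Icc.2 hab) (hess L (y b))
  exact ⟨k, h0, fun t ht i j => by simpa only [sub_eq_add_neg] using hk t ht i j⟩

/-- The second-order analogue of `SolvesAdjointOn.pairing_eq`. -/
theorem IsBackwardHessian.pairing_eq (hF : ContDiff ℝ ∞ F) {σ : ℝ → Fin D → ℝ}
    {h : ℝ → Matrix (Fin D) (Fin D) ℝ} (hσ : SolvesAdjointOn F a b y σ)
    (hh : IsBackwardHessian F L a b y σ h) {w ζ η : ℝ → State D}
    (hw : SolvesVariationOn F a b y w) (hζ : SolvesVariationOn F a b y ζ)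
    (hη : ∀ t ∈ Icc a b, HasDerivWithinAt η
      (fderiv ℝ (fderiv ℝ F) (y t) (ζ t) (w t) + fderiv ℝ F (y t) (η t)) (Icc a b) t)
    (hab : a ≤ b) :
    (∑ i, ∑ j, h a i j * w a i * ζ a j) + ∑ i, σ a i * η a i =
      (∑ i, ∑ j, h b i j * w b i * ζ b j) + ∑ i, σ b i * η b i := by
  refine hasDerivWithinAt_Icc_unique
    (z := fun t => (∑ i, ∑ j, h t i j * w t i * ζ t j) + ∑ i, σ t i * η t i)
    (w := fun _ => (∑ i, ∑ j, h b i j * w b i * ζ b j) + ∑ i, σ b i * η b i)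
    (g := fun _ => 0) (right_mem_Icc.2 hab) (fun t ht => ?_)
    (fun t _ => hasDerivWithinAt_const _ _ _) rfl a (left_mem_Icc.2 hab)
  refine ((HasDerivWithinAt.fun_sum fun i _ => HasDerivWithinAt.fun_sum fun j _ =>
    ((hh.2 t ht i j).mul (hasDerivWithinAt_coord (hw t ht) i)).mul
      (hasDerivWithinAt_coord (hζ t ht) j)).add (HasDerivWithinAt.fun_sum fun i _ =>
    (hσ t ht i).mul (hasDerivWithinAt_coord (hη t ht) i))).congr_deriv ?_
  -- The terms of the product rule cancel in pairs: `e1` and `e2` move the Jacobians from `h` to `w`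
  -- and `ζ`, `e3` matches the curvature term with the source of `η`, and `e4` matches `σ'` with the
  -- linear part of `η'`.
  have e1 : ∑ i, ∑ j, (∑ m, h t m j * jac F (y t) m i) * w t i * ζ t j =
      ∑ i, ∑ j, h t i j * fderiv ℝ F (y t) (w t) i * ζ t j := by
    simp only [fderiv_apply_eq_sum_jac hF, Finset.sum_mul, Finset.mul_sum]
    rw [Finset.sum_comm, Finset.sum_congr rfl fun j _ => Finset.sum_comm, Finset.sum_comm]
    exact Finset.sum_congr rfl fun i _ => Finset.sum_congr rfl fun j _ =>
      Finset.sum_congr rfl fun m _ => by ring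
  have e2 : ∑ i, ∑ j, (∑ m, h t i m * jac F (y t) m j) * w t i * ζ t j =
      ∑ i, ∑ j, h t i j * w t i * fderiv ℝ F (y t) (ζ t) j := by
    simp only [fderiv_apply_eq_sum_jac hF, Finset.sum_mul, Finset.mul_sum]
    refine Finset.sum_congr rfl fun i _ => ?_
    rw [Finset.sum_comm]
    exact Finset.sum_congr rfl fun j _ => Finset.sum_congr rfl fun m _ => by ring
  have e3 : ∑ i, ∑ j, curvatureTerm F y σ t i j * w t i * ζ t j =
      ∑ m, σ t m * fderiv ℝ (fderiv ℝ F) (y t) (ζ t) (w t) m := by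
    simp only [fderiv_fderiv_apply_eq_sum_jac2 hF, curvatureTerm, Finset.sum_mul, Finset.mul_sum]
    rw [Finset.sum_congr rfl fun i _ => Finset.sum_comm, Finset.sum_comm]
    exact Finset.sum_congr rfl fun i _ => Finset.sum_congr rfl fun j _ =>
      Finset.sum_congr rfl fun m _ => by ring
  have e4 : ∑ i, (∑ k, σ t k * jac F (y t) k i) * η t i =
      ∑ k, σ t k * fderiv ℝ F (y t) (η t) k := by
    simp only [fderiv_apply_eq_sum_jac hF, Finset.sum_mul, Finset.mul_sum]
    rw [Finset.sum_comm]
    exact Finset.sum_congr rfl fun j _ => Finset.sum_congr rfl fun m _ => by ring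
  simp only [sub_mul, neg_mul, add_mul, mul_add, Finset.sum_add_distrib, Finset.sum_sub_distrib,
    Finset.sum_neg_distrib, PiLp.add_apply, Pi.mul_apply, e1, e2, e3, e4]
  ring

end Adjoint

/-! ### Gradient and Hessian of the end-state loss -/

section Flow

variable {D : ℕ} {F : State D → State D} {L : State D → ℝ} {a b : ℝ} {y : ℝ → State D}

theorem isEndMap_flowMap (hF : ContDiff ℝ ∞ F) (hab : a ≤ b) : IsEndMap F a b (flowMap F a b) := by
  intro z hz
  have hx : ∃ y : ℝ → State D, IsTrajectory F a b y ∧ y a = z a := ⟨z, hz, rfl⟩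
  rw [flowMap, dif_pos hx]
  exact SolvesOn.eq_of_left_eq (hF.of_le (by norm_cast)) hx.choose_spec.1 hz hx.choose_spec.2 b
    (right_mem_Icc.2 hab)

theorem contDiffAt_lossFrom (hF : ContDiff ℝ ∞ F) (hL : ContDiff ℝ ∞ L) (hab : a ≤ b)
    (hy : SolvesOn F a b y) : ContDiffAt ℝ ∞ (lossFrom F L a b) (y a) :=
  hL.contDiffAt.comp (y a) ((isEndMap_flowMap hF hab).smooth hF hab hy).1

theorem IsBackwardHessian.mono {σ : ℝ → Fin D → ℝ} {h : ℝ → Matrix (Fin D) (Fin D) ℝ}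
    (hh : IsBackwardHessian F L a b y σ h) {t : ℝ} (ht : t ∈ Icc a b) :
    IsBackwardHessian F L t b y σ h :=
  ⟨hh.1, fun s hs i j => (hh.2 s (Icc_subset_Icc_left ht.1 hs) i j).mono (Icc_subset_Icc_left ht.1)⟩

theorem IsTruncatedHessian.mono {k : ℝ → Matrix (Fin D) (Fin D) ℝ}
    (hk : IsTruncatedHessian F L a b y k) {t : ℝ} (ht : t ∈ Icc a b) :
    IsTruncatedHessian F L t b y k :=
  ⟨hk.1, fun s hs i j => (hk.2 s (Icc_subset_Icc_left ht.1 hs) i j).mono (Icc_subset_Icc_left ht.1)⟩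

theorem IsCostate.mono {σ : ℝ → Fin D → ℝ} (hσ : IsCostate F L a b y σ) {t : ℝ}
    (ht : t ∈ Icc a b) : IsCostate F L t b y σ :=
  ⟨hσ.1, SolvesAdjointOn.mono hσ.2 ht⟩

theorem IsCostate.grad_lossFrom_left (hF : ContDiff ℝ ∞ F) (hL : ContDiff ℝ ∞ L) (hab : a ≤ b)
    (hy : SolvesOn F a b y) {σ : ℝ → Fin D → ℝ} (hσ : IsCostate F L a b y σ) :
    grad (lossFrom F L a b) (y a) = σ a := by
  ext i
  obtain ⟨w, hw0, hw⟩ := exists_variation hF hy.continuousOn (left_mem_Icc.2 hab)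
    (EuclideanSpace.single i (1 : ℝ))
  have h1 := (isEndMap_flowMap hF hab).fderiv_comp hF hab hL hy hw
  have h2 := SolvesAdjointOn.pairing_eq hF hσ.2 hw hab
  rw [fderiv_eq_sum_grad L, ← hσ.1, ← h2, hw0] at h1
  exact h1.trans (by simp)

theorem IsCostate.grad_lossFrom (hF : ContDiff ℝ ∞ F) (hL : ContDiff ℝ ∞ L)
    (hy : SolvesOn F a b y) {σ : ℝ → Fin D → ℝ} (hσ : IsCostate F L a b y σ) {t : ℝ}
    (ht : t ∈ Icc a b) : grad (lossFrom F L t b) (y t) = σ t :=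
  (hσ.mono ht).grad_lossFrom_left hF hL ht.2 (hy.mono ht)

theorem IsBackwardHessian.hess_lossFrom_left (hF : ContDiff ℝ ∞ F) (hL : ContDiff ℝ ∞ L)
    (hab : a ≤ b) (hy : SolvesOn F a b y) {σ : ℝ → Fin D → ℝ}
    {h : ℝ → Matrix (Fin D) (Fin D) ℝ} (hσ : IsCostate F L a b y σ)
    (hh : IsBackwardHessian F L a b y σ h) : hess (lossFrom F L a b) (y a) = h a := by
  ext i j
  have ha := left_mem_Icc.2 hab
  obtain ⟨w, hw0, hw⟩ := exists_variation hF hy.continuousOn ha (EuclideanSpace.single i (1 : ℝ))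
  obtain ⟨ζ, hζ0, hζ⟩ := exists_variation hF hy.continuousOn ha (EuclideanSpace.single j (1 : ℝ))
  have hF' : ContDiff ℝ ∞ (fderiv ℝ F) := hF.fderiv_right (by simp)
  obtain ⟨η, hη0, hη⟩ := exists_linear_solution (A := fun t => fderiv ℝ F (y t))
    (B := fun t => fderiv ℝ (fderiv ℝ F) (y t) (ζ t) (w t))
    ((hF.continuous_fderiv (by simp)).comp_continuousOn hy.continuousOn)
    ((((hF'.continuous_fderiv (by simp)).comp_continuousOn hy.continuousOn).clm_apply
      hζ.continuousOn).clm_apply hw.continuousOn) ha 0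
  have hη' : ∀ t ∈ Icc a b, HasDerivWithinAt η
      (fderiv ℝ (fderiv ℝ F) (y t) (ζ t) (w t) + fderiv ℝ F (y t) (η t)) (Icc a b) t :=
    fun t ht => (hη t ht).congr_deriv (add_comm _ _)
  have h1 := (isEndMap_flowMap hF hab).fderiv_fderiv_comp hF hab hL hy hw hζ hη' hη0
  have h2 := hh.pairing_eq hF hσ.2 hw hζ hη' hab
  rw [fderiv_eq_sum_grad L, fderiv_fderiv_eq_sum_hess (hL.of_le (by norm_cast)).contDiffAt,
    ← hσ.1, ← hh.1, ← h2, hη0, hw0, hζ0] at h1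
  rw [hess_eq_fderiv ((contDiffAt_lossFrom hF hL hab hy).of_le (by norm_cast))]
  exact h1.trans (by simp)

theorem IsBackwardHessian.hess_lossFrom (hF : ContDiff ℝ ∞ F) (hL : ContDiff ℝ ∞ L)
    (hy : SolvesOn F a b y) {σ : ℝ → Fin D → ℝ}
    {h : ℝ → Matrix (Fin D) (Fin D) ℝ} (hσ : IsCostate F L a b y σ)
    (hh : IsBackwardHessian F L a b y σ h) {t : ℝ} (ht : t ∈ Icc a b) :
    hess (lossFrom F L t b) (y t) = h t :=
  (hh.mono ht).hess_lossFrom_left hF hL ht.2 (hy.mono ht) (hσ.mono ht)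

/-- If `k` is the Hessian, it coincides with a solution `H` of the full equation; derivatives within
a nondegenerate interval are unique, so the two right-hand sides agree. Conversely, without the term
`k` itself solves the full equation. -/
theorem IsTruncatedHessian.eq_hess_lossFrom_iff (hF : ContDiff ℝ ∞ F) (hL : ContDiff ℝ ∞ L)
    (hab : a < b) (hy : SolvesOn F a b y) {σ : ℝ → Fin D → ℝ}
    {k : ℝ → Matrix (Fin D) (Fin D) ℝ} (hσ : IsCostate F L a b y σ)
    (hk : IsTruncatedHessian F L a b y k) :
    (∀ t ∈ Icc a b, k t = hess (lossFrom F L t b) (y t)) ↔ CurvatureTermVanishes F a b y σ := by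
  constructor
  · intro h t ht i j
    obtain ⟨H, hH⟩ := exists_isBackwardHessian hF hy.continuousOn hab.le L hσ.2
    have hkH : ∀ s ∈ Icc a b, H s i j = k s i j := fun s hs => by
      rw [h s hs, hH.hess_lossFrom hF hL hy hσ hs]
    have h1 := (hk.2 t ht i j).congr hkH (hkH t ht)
    have h2 := (uniqueDiffOn_Icc hab t ht).eq_deriv _ h1 (hH.2 t ht i j)
    have h3 : k t = H t := by rw [h t ht, hH.hess_lossFrom hF hL hy hσ ht]
    rw [h3] at h2
    linarith
  · intro h t ht
    have hH : IsBackwardHessian F L a b y σ k := ⟨hk.1, fun s hs i j => by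
      rw [h s hs i j, sub_zero]
      exact hk.2 s hs i j⟩
    exact (hH.hess_lossFrom hF hL hy hσ ht).symm

theorem IsCostate.vanishes_of_grad_eq_zero (hF : ContDiff ℝ ∞ F) (hy : SolvesOn F a b y)
    {σ : ℝ → Fin D → ℝ} (hσ : IsCostate F L a b y σ) (h : grad L (y b) = 0) :
    (∀ t ∈ Icc a b, σ t = 0) ∧ CurvatureTermVanishes F a b y σ := by
  have h0 := SolvesAdjointOn.eq_zero hF hy.continuousOn hσ.2 (hσ.1.trans h)
  exact ⟨h0, fun t ht i j => by simp [curvatureTerm, h0 t ht]⟩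

theorem jac2_eq_zero_of_isAffineField (hF : ContDiff ℝ ∞ F) (h : IsAffineField F) (x : State D)
    (m i j : Fin D) : jac2 F x m i j = 0 := by
  obtain ⟨A, c, hA⟩ := h
  have hF' : fderiv ℝ F = fun _ => LinearMap.toContinuousLinearMap A := by
    rw [show F = fun x => LinearMap.toContinuousLinearMap A x + c from funext hA]
    ext1 x
    exact ((LinearMap.toContinuousLinearMap A).hasFDerivAt.add_const c).fderiv
  rw [jac2_eq_fderiv hF, hF']
  simp

theorem isAffineField_of_jac2_eq_zero (hF : ContDiff ℝ ∞ F)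
    (h : ∀ x m i j, jac2 F x m i j = 0) : IsAffineField F := by
  have hdF : Differentiable ℝ (fderiv ℝ F) :=
    (hF.fderiv_right (m := ∞) (by simp)).differentiable (by simp)
  have h2 : ∀ x, fderiv ℝ (fderiv ℝ F) x = 0 := fun x => by
    ext ζ w m
    rw [fderiv_fderiv_apply_eq_sum_jac2 hF]
    simp [h]
  have h1 : ∀ x, fderiv ℝ F x = fderiv ℝ F 0 := fun x => is_const_of_fderiv_eq_zero hdF h2 x 0
  have h0 : ∀ x, fderiv ℝ (fun x => F x - fderiv ℝ F 0 x) x = 0 := fun x => by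
    rw [((hF.differentiable (by simp) x).hasFDerivAt.fun_sub (fderiv ℝ F 0).hasFDerivAt).fderiv, h1,
      sub_self]
  refine ⟨fderiv ℝ F 0, F 0, fun x => ?_⟩
  have := is_const_of_fderiv_eq_zero
    ((hF.differentiable (by simp)).fun_sub (fderiv ℝ F 0).differentiable) h0 x 0
  simp only [map_zero, sub_zero] at this
  rw [← this]
  simp

theorem curvatureTerm_eq_zero_of_jac2_eq_zero {σ : ℝ → Fin D → ℝ} {t : ℝ} {i j : Fin D}
    (h : ∀ m, jac2 F (y t) m i j = 0) : curvatureTerm F y σ t i j = 0 := by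
  simp [curvatureTerm, h]

/-! ### Terminal gradients for which the term vanishes -/

/-- The terminal gradients for which the curvature term vanishes along `y`. -/
def vanishingSubspace (hF : ContDiff ℝ ∞ F) (hab : a ≤ b) (hy : SolvesOn F a b y) :
    Submodule ℝ (Fin D → ℝ) where
  carrier := {g | ∀ σ, SolvesAdjointOn F a b y σ → σ b = g → CurvatureTermVanishes F a b y σ}
  zero_mem' := fun σ hσ h t ht i j => by
    simp [curvatureTerm, hσ.eq_zero hF hy.continuousOn h t ht]
  add_mem' := by
    intro g₁ g₂ h₁ h₂ σ hσ h t ht i j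
    -- Split `σ` as `τ + (σ - τ)`, with terminal values `g₁` and `g₂`.
    obtain ⟨τ, hτ0, hτ⟩ := exists_solvesAdjointOn hF hy.continuousOn (right_mem_Icc.2 hab) g₁
    have e1 := h₁ τ hτ hτ0 t ht i j
    have e2 := h₂ _ (hσ.sub hτ) (by ext i; simp [h, hτ0]) t ht i j
    simp only [curvatureTerm, sub_mul, Finset.sum_sub_distrib] at e1 e2 ⊢
    linarith
  smul_mem' := by
    intro c g h σ hσ hσ0 t ht i j
    rcases eq_or_ne c 0 with rfl | hc
    · simp [curvatureTerm, hσ.eq_zero hF hy.continuousOn (by simp [hσ0]) t ht]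
    · have e := h _ (hσ.const_mul c⁻¹) (by ext i; simp [hσ0, hc]) t ht i j
      simp only [curvatureTerm, mul_assoc, ← Finset.mul_sum] at e ⊢
      exact (mul_eq_zero.1 e).resolve_left (inv_ne_zero hc)

theorem mem_vanishingSubspace_iff (hF : ContDiff ℝ ∞ F) (hab : a ≤ b) (hy : SolvesOn F a b y)
    {σ : ℝ → Fin D → ℝ} (hσ : SolvesAdjointOn F a b y σ) :
    σ b ∈ vanishingSubspace hF hab hy ↔ CurvatureTermVanishes F a b y σ := by
  refine ⟨fun h => h σ hσ rfl, fun h τ hτ hτ0 t ht i j => ?_⟩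
  rw [← h t ht i j, curvatureTerm, hτ.eq_of_right_eq hF hy.continuousOn hσ hτ0 t ht]
  rfl

/-- Prescribing the costate as a basis vector at the time `t` in question, rather than at `b`,
reduces the term there to a single second derivative of `F`. -/
theorem vanishingSubspace_eq_top_iff (hF : ContDiff ℝ ∞ F) (hab : a ≤ b)
    (hy : SolvesOn F a b y) :
    vanishingSubspace hF hab hy = ⊤ ↔ ∀ t ∈ Icc a b, ∀ m i j, jac2 F (y t) m i j = 0 := by
  constructor
  · intro h t ht m i j
    obtain ⟨σ, hσ0, hσ⟩ := exists_solvesAdjointOn hF hy.continuousOn ht (Pi.single m 1)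
    have := (mem_vanishingSubspace_iff hF hab hy hσ).1 (h ▸ Submodule.mem_top) t ht i j
    simpa [curvatureTerm, hσ0, Pi.single_apply] using this
  · intro h
    exact eq_top_iff.2 fun g _ σ _ _ t ht i j =>
      curvatureTerm_eq_zero_of_jac2_eq_zero fun m => h t ht m i j

/-! ### Fields and losses for which the truncated equation fails -/

/-- A curvature term that is nonzero at the end time makes the truncated equation fail just
before the end time. -/
theorem exists_truncated_ne (hF : ContDiff ℝ ∞ F) (hL : ContDiff ℝ ∞ L) (hab : a < b)
    (hy : SolvesOn F a b y) {σ : ℝ → Fin D → ℝ} (hσ : IsCostate F L a b y σ) {i j : Fin D}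
    (hij : curvatureTerm F y σ b i j ≠ 0) :
    ∃ t ∈ Ico a b, ∃ k, IsTruncatedHessian F L t b y k ∧
      k t ≠ hess (lossFrom F L t b) (y t) := by
  have hb := right_mem_Icc.2 hab.le
  obtain ⟨h, hh⟩ := exists_isBackwardHessian hF hy.continuousOn hab.le L hσ.2
  obtain ⟨k, hk⟩ := exists_isTruncatedHessian hF hy.continuousOn hab.le L
  have hd := (hh.2 b hb i j).sub (hk.2 b hb i j)
  -- `h - k` is zero at `b`, with derivative minus the curvature term there, so it is nonzero just
  -- to the left of `b`.
  have hne := hd.eventually_ne (c := 0) (by rw [hh.1, hk.1]; ring_nf; simpa using hij)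
  rw [Icc_sdiff_right] at hne
  have : (𝓝[Ico a b] b).NeBot := by
    rw [nhdsWithin_Ico_eq_nhdsLT hab]
    infer_instance
  obtain ⟨t, ht0, ht⟩ := (hne.and self_mem_nhdsWithin).exists
  have ht' := Ico_subset_Icc_self ht
  refine ⟨t, ht, k, hk.mono ht', fun e => ht0 ?_⟩
  rw [hh.hess_lossFrom hF hL hy hσ ht'] at e
  simp [e]

/-- A trajectory ends at time `0` at a point with a nonzero second derivative of the component
`F_m`. The loss `z ↦ z m` has terminal costate `e_m`, so the term is nonzero there. The start time
is then moved close enough to `0` for `k` to be wrong at the start. -/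
theorem exists_curvature_of_not_isAffineField (hF : ContDiff ℝ ∞ F) (hA : ¬ IsAffineField F) :
    ∃ (tS tE : ℝ) (y : ℝ → State D) (L : State D → ℝ) (σ : ℝ → Fin D → ℝ)
      (k : ℝ → Matrix (Fin D) (Fin D) ℝ),
      tS < tE ∧ IsTrajectory F tS tE y ∧ ContDiff ℝ ∞ L ∧
      IsCostate F L tS tE y σ ∧ IsTruncatedHessian F L tS tE y k ∧
      ¬ CurvatureTermVanishes F tS tE y σ ∧
      k tS ≠ hess (lossFrom F L tS tE) (y tS) := by
  obtain ⟨x, m, i, j, hx⟩ : ∃ x m i j, jac2 F x m i j ≠ 0 := by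
    by_contra! h
    exact hA (isAffineField_of_jac2_eq_zero hF h)
  obtain ⟨y, hy0, ε, hε, hy⟩ :=
    (hF.of_le (m := 1) (by norm_cast)).contDiffAt (x := x)
      |>.exists_forall_mem_closedBall_exists_eq_forall_mem_Ioo_hasDerivAt₀ 0
  have hab : -(ε / 2) < 0 := by linarith
  have hsol : SolvesOn F (-(ε / 2)) 0 y := fun t ht =>
    (hy t ⟨by linarith [ht.1], by linarith [ht.2]⟩).hasDerivWithinAt
  let L : State D → ℝ := fun z => z m
  have hL : ContDiff ℝ ∞ L := (EuclideanSpace.proj (𝕜 := ℝ) m).contDiff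
  obtain ⟨σ, hσ⟩ := exists_isCostate hF hsol.continuousOn hab.le L
  have hσ0 : σ 0 = Pi.single m 1 := by
    rw [hσ.1]
    ext l
    change fderiv ℝ (EuclideanSpace.proj (𝕜 := ℝ) m) (y 0) (EuclideanSpace.single l 1) = _
    rw [ContinuousLinearMap.fderiv]
    simp [Pi.single_apply, eq_comm]
  have hC : curvatureTerm F y σ 0 i j ≠ 0 := by
    simpa [curvatureTerm, hσ0, hy0, Pi.single_apply] using hx
  obtain ⟨t, ht, k, hk, hne⟩ := exists_truncated_ne hF hL hab hsol hσ hC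
  have ht' := Ico_subset_Icc_self ht
  exact ⟨t, 0, y, L, σ, k, ht.2, hsol.mono ht', hL, hσ.mono ht', hk,
    fun h => hC (h 0 (right_mem_Icc.2 ht.2.le) i j), hne⟩

/-- The field `(x_m - c)² e_m`. -/
noncomputable def squareField (m : Fin D) (c : ℝ) (x : State D) : State D :=
  (x m - c) ^ 2 • EuclideanSpace.single m 1

theorem contDiff_squareField (m : Fin D) (c : ℝ) : ContDiff ℝ ∞ (squareField m c) :=
  (((EuclideanSpace.proj (𝕜 := ℝ) m).contDiff.sub contDiff_const).pow 2).smul contDiff_const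

theorem jac_squareField (m : Fin D) (c : ℝ) (x : State D) (k i : Fin D) :
    jac (squareField m c) x k i =
      2 * (x m - c) * (Pi.single m 1 : Fin D → ℝ) i * (Pi.single m 1 : Fin D → ℝ) k := by
  have h := ((((EuclideanSpace.proj (𝕜 := ℝ) m).hasFDerivAt (x := x)).sub_const c).pow 2).smul_const
    (EuclideanSpace.single m (1 : ℝ))
  have h' : HasFDerivAt (squareField m c) _ x := h
  rw [jac_eq_fderiv (contDiff_squareField m c), h'.fderiv]
  rcases eq_or_ne m i with rfl | hi
  · simp [Pi.single_apply]
  · simp [hi, hi.symm]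

theorem jac2_squareField (m : Fin D) (c : ℝ) (x : State D) (k i j : Fin D) :
    jac2 (squareField m c) x k i j = 2 * (Pi.single m 1 : Fin D → ℝ) j *
      (Pi.single m 1 : Fin D → ℝ) i * (Pi.single m 1 : Fin D → ℝ) k := by
  have h := ((((((EuclideanSpace.proj (𝕜 := ℝ) m).hasFDerivAt (x := x)).sub_const c).const_mul
    2).mul_const ((Pi.single m 1 : Fin D → ℝ) i)).mul_const ((Pi.single m 1 : Fin D → ℝ) k))
  change fderiv ℝ (fun z => jac (squareField m c) z k i) x (EuclideanSpace.single j 1) = _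
  simp only [jac_squareField]
  refine (congrArg (fun f : State D →L[ℝ] ℝ => f (EuclideanSpace.single j 1)) h.fderiv).trans ?_
  have e : EuclideanSpace.proj (𝕜 := ℝ) m (EuclideanSpace.single j 1) =
      (Pi.single m 1 : Fin D → ℝ) j := by simp [Pi.single_apply, eq_comm]
  simp only [smul_apply, smul_eq_mul, e]
  ring

/-- `squareField` and its Jacobian vanish at `yE`, so the trajectory, `σ` and `k` are all constant,
while the `m, m` entry of `h` has constant slope `-2 g_m`, where `g` is the gradient at `yE`. Hence
`h - k` equals `2 (b - a) g_m` in that entry at the start, nonzero for every interval length. -/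
theorem exists_curvature_of_grad_ne_zero (hL : ContDiff ℝ ∞ L) {yE : State D}
    (hg : grad L yE ≠ 0) (hab : a < b) :
    ∃ (F : State D → State D) (y : ℝ → State D) (σ : ℝ → Fin D → ℝ)
      (k : ℝ → Matrix (Fin D) (Fin D) ℝ),
      ContDiff ℝ ∞ F ∧ IsTrajectory F a b y ∧ y b = yE ∧
      IsCostate F L a b y σ ∧ IsTruncatedHessian F L a b y k ∧
      ¬ CurvatureTermVanishes F a b y σ ∧
      k a ≠ hess (lossFrom F L a b) (y a) := by
  obtain ⟨m, hm⟩ := Function.ne_iff.1 hg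
  have hF := contDiff_squareField m (yE m)
  have hj : ∀ k i, jac (squareField m (yE m)) yE k i = 0 := fun k i => by simp [jac_squareField]
  have hy : SolvesOn (squareField m (yE m)) a b fun _ => yE := fun t _ =>
    (hasDerivWithinAt_const t _ yE).congr_deriv (by simp [squareField])
  have hσ : IsCostate (squareField m (yE m)) L a b (fun _ => yE) fun _ => grad L yE :=
    ⟨rfl, fun t _ i => by simpa [hj] using hasDerivWithinAt_const t (Icc a b) (grad L yE i)⟩
  have hk : IsTruncatedHessian (squareField m (yE m)) L a b (fun _ => yE) fun _ => hess L yE :=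
    ⟨rfl, fun t _ i j => by simpa [hj] using hasDerivWithinAt_const t (Icc a b) (hess L yE i j)⟩
  have hC : ∀ t, curvatureTerm (squareField m (yE m)) (fun _ => yE) (fun _ => grad L yE) t m m =
      2 * grad L yE m := fun t => by
    simp [curvatureTerm, jac2_squareField, Pi.single_apply, mul_comm]
  have hC0 : ∀ t, curvatureTerm (squareField m (yE m)) (fun _ => yE) (fun _ => grad L yE) t m m
      ≠ 0 := fun t => by
    rw [hC]
    exact mul_ne_zero two_ne_zero hm
  refine ⟨_, fun _ => yE, _, _, hF, hy, rfl, hσ, hk,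
    fun h => hC0 a (h a (left_mem_Icc.2 hab.le) m m), fun e => ?_⟩
  obtain ⟨h, hh⟩ := exists_isBackwardHessian hF hy.continuousOn hab.le L hσ.2
  rw [hh.hess_lossFrom_left hF hL hab.le hy hσ] at e
  have hd : ∀ t ∈ Icc a b, HasDerivWithinAt (fun s => h s m m) (-(2 * grad L yE m)) (Icc a b) t :=
    fun t ht => (hh.2 t ht m m).congr_deriv (by simp [hj, hC])
  -- The explicit affine solution for the `m, m` entry, to be compared with `h`.
  have hl : ∀ t ∈ Icc a b, HasDerivWithinAt
      (fun s => hess L yE m m + (b - s) * (2 * grad L yE m)) (-(2 * grad L yE m)) (Icc a b) t :=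
    fun t _ => ((((hasDerivWithinAt_id t _).const_sub b).mul_const _).const_add _).congr_deriv
      (by ring)
  have key := hasDerivWithinAt_Icc_unique (right_mem_Icc.2 hab.le) hd hl (by rw [hh.1]; simp) a
    (left_mem_Icc.2 hab.le)
  simp only [← e, left_eq_add, mul_eq_zero, sub_eq_zero, hab.ne', OfNat.ofNat_ne_zero,
    false_or] at key
  exact hm key

end Flow

theorem mainTheorem1 (D : ℕ) :
    -- The backward system is solvable and gives the gradient and the Hessian of the end-state
    -- loss as a function of the state at time `t`, for every `t` in `[tS, tE]`.
    (∀ (F : State D → State D) (L : State D → ℝ), ContDiff ℝ ∞ F → ContDiff ℝ ∞ L →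
      ∀ (tS tE : ℝ), tS < tE → ∀ y : ℝ → State D, IsTrajectory F tS tE y →
        (∃ (σ : ℝ → Fin D → ℝ) (h : ℝ → Matrix (Fin D) (Fin D) ℝ),
          IsCostate F L tS tE y σ ∧ IsBackwardHessian F L tS tE y σ h) ∧
        (∀ t ∈ Icc tS tE,
          (∀ᶠ x in 𝓝 (y t), ∃ z : ℝ → State D, IsTrajectory F t tE z ∧ z t = x) ∧
          (∀ z : ℝ → State D, IsTrajectory F t tE z → flowMap F t tE (z t) = z tE) ∧
          ContDiffAt ℝ 2 (lossFrom F L t tE) (y t)) ∧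
        (∀ (σ : ℝ → Fin D → ℝ) (h : ℝ → Matrix (Fin D) (Fin D) ℝ),
          IsCostate F L tS tE y σ → IsBackwardHessian F L tS tE y σ h →
          ∀ t ∈ Icc tS tE,
            grad (lossFrom F L t tE) (y t) = σ t ∧ hess (lossFrom F L t tE) (y t) = h t)) ∧
    -- The truncated equation is solvable; it gives the Hessian at all times if and only if the
    -- curvature term vanishes along the trajectory.
    (∀ (F : State D → State D) (L : State D → ℝ), ContDiff ℝ ∞ F → ContDiff ℝ ∞ L →
      ∀ (tS tE : ℝ), tS < tE → ∀ y : ℝ → State D, IsTrajectory F tS tE y →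
        (∃ k : ℝ → Matrix (Fin D) (Fin D) ℝ, IsTruncatedHessian F L tS tE y k) ∧
        ∀ (σ : ℝ → Fin D → ℝ) (k : ℝ → Matrix (Fin D) (Fin D) ℝ),
          IsCostate F L tS tE y σ → IsTruncatedHessian F L tS tE y k →
          ((∀ t ∈ Icc tS tE, k t = hess (lossFrom F L t tE) (y t)) ↔
            CurvatureTermVanishes F tS tE y σ)) ∧
    -- The term vanishes if `F` is affine, and if the end point is critical (then `σ = 0`).
    (∀ (F : State D → State D) (L : State D → ℝ), ContDiff ℝ ∞ F → ContDiff ℝ ∞ L →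
      ∀ (tS tE : ℝ), tS < tE → ∀ y : ℝ → State D, IsTrajectory F tS tE y →
        ∀ σ : ℝ → Fin D → ℝ, IsCostate F L tS tE y σ →
          (IsAffineField F → CurvatureTermVanishes F tS tE y σ) ∧
          (grad L (y tE) = 0 →
            (∀ t ∈ Icc tS tE, σ t = 0) ∧ CurvatureTermVanishes F tS tE y σ)) ∧
    -- Along a given trajectory, the term vanishes exactly for terminal gradients in a linear
    -- subspace, which is proper unless the second derivatives of `F` vanish on the trajectory.
    (∀ F : State D → State D, ContDiff ℝ ∞ F →
      ∀ (tS tE : ℝ), tS < tE → ∀ y : ℝ → State D, IsTrajectory F tS tE y →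
        ∃ W : Submodule ℝ (Fin D → ℝ),
          (∀ L : State D → ℝ, ContDiff ℝ ∞ L → ∀ σ : ℝ → Fin D → ℝ,
            IsCostate F L tS tE y σ →
            (CurvatureTermVanishes F tS tE y σ ↔ grad L (y tE) ∈ W)) ∧
          (W = ⊤ ↔ ∀ t ∈ Icc tS tE, ∀ m i j, jac2 F (y t) m i j = 0)) ∧
    -- No velocity field other than the affine ones makes the term vanish for all losses and
    -- trajectories.
    (∀ F : State D → State D, ContDiff ℝ ∞ F → ¬ IsAffineField F →
      ∃ (tS tE : ℝ) (y : ℝ → State D) (L : State D → ℝ) (σ : ℝ → Fin D → ℝ)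
        (k : ℝ → Matrix (Fin D) (Fin D) ℝ),
        tS < tE ∧ IsTrajectory F tS tE y ∧ ContDiff ℝ ∞ L ∧
        IsCostate F L tS tE y σ ∧ IsTruncatedHessian F L tS tE y k ∧
        ¬ CurvatureTermVanishes F tS tE y σ ∧
        k tS ≠ hess (lossFrom F L tS tE) (y tS)) ∧
    -- No end point other than a critical one makes the term vanish for all velocity fields.
    (∀ L : State D → ℝ, ContDiff ℝ ∞ L → ∀ yE : State D, grad L yE ≠ 0 →
      ∀ (tS tE : ℝ), tS < tE →
      ∃ (F : State D → State D) (y : ℝ → State D) (σ : ℝ → Fin D → ℝ)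
        (k : ℝ → Matrix (Fin D) (Fin D) ℝ),
        ContDiff ℝ ∞ F ∧ IsTrajectory F tS tE y ∧ y tE = yE ∧
        IsCostate F L tS tE y σ ∧ IsTruncatedHessian F L tS tE y k ∧
        ¬ CurvatureTermVanishes F tS tE y σ ∧
        k tS ≠ hess (lossFrom F L tS tE) (y tS)) := by
  refine ⟨?_, ?_, ?_, ?_, fun F hF hA => exists_curvature_of_not_isAffineField hF hA,
    fun L hL yE hg tS tE hab => exists_curvature_of_grad_ne_zero hL hg hab⟩
  · intro F L hF hL a b hab y hy
    have hyc := SolvesOn.continuousOn hy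
    obtain ⟨σ, hσ⟩ := exists_isCostate hF hyc hab.le L
    obtain ⟨h, hh⟩ := exists_isBackwardHessian hF hyc hab.le L hσ.2
    refine ⟨⟨σ, h, hσ, hh⟩, fun t ht => ⟨?_, isEndMap_flowMap hF ht.2, ?_⟩,
      fun σ h hσ hh t ht => ⟨hσ.grad_lossFrom hF hL hy ht, hh.hess_lossFrom hF hL hy hσ ht⟩⟩
    · exact (SolvesOn.mono hy ht).eventually_exists hF ht.2
    · exact (contDiffAt_lossFrom hF hL ht.2 (SolvesOn.mono hy ht)).of_le (by norm_cast)
  · intro F L hF hL a b hab y hy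
    exact ⟨exists_isTruncatedHessian hF (SolvesOn.continuousOn hy) hab.le L,
      fun σ k hσ hk => hk.eq_hess_lossFrom_iff hF hL hab hy hσ⟩
  · intro F L hF hL a b hab y hy σ hσ
    exact ⟨fun hA t _ i j => curvatureTerm_eq_zero_of_jac2_eq_zero fun m =>
      jac2_eq_zero_of_isAffineField hF hA _ m i j, hσ.vanishes_of_grad_eq_zero hF hy⟩
  · intro F hF a b hab y hy
    refine ⟨vanishingSubspace hF hab.le hy, fun L _ σ hσ => ?_,
      vanishingSubspace_eq_top_iff hF hab.le hy⟩
    rw [← hσ.1]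
    exact (mem_vanishingSubspace_iff hF hab.le hy hσ.2).symm
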